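/- Let $k$ be a field, let $(A,d)$ be a graded commutative differential graded $k$-algebra ($ab=(-1)^{|a||b|}ba$, with $d$ a derivation of degree $+1$ and $d^2=0$), and let $n\ge 0$. Let $E(n,A)$ be the quotient of the graded algebra $A^{\otimes n}\otimes\Lambda(e_{ij} : 1\le i<j\le n)$ (with Koszul signs for the total degree) by the ideal generated by the elements $(e_i(a)-e_j(a))\,e_{ij}$, $a\in A$, where $e_i(a)=1\otimes\cdots\otimes a\otimes\cdots\otimes 1$ with $a$ in the $i$-th position. It is bigraded: for homogeneous $a_i$, the class of $a_1\otimes\cdots\otimes a_n$ has bidegree $(\sum_i|a_i|,0)$, and $e_{ij}$ has bidegree $(0,1)$. Let $d=d'+d''$, where $d'$ is left multiplication by $\sum_{i<j}e_{ij}$, of bidegree $(0,1)$, and $d''$, of bidegree $(1,0)$, is the derivation induced by the differential of $A$, with $d''e_{ij}=0$. Let $J\subset E(n,A)$ be the two-sided ideal generated by the products $e_{ir}e_{jr}$ ($i<r$, $j<r$). Then: 1. $J$ is a sub-bicomplex of $E(n,A)$: it is the direct sum of its bihomogeneous components $J\cap E(n,A)^{p,q}$, it is stable under $d'$ and $d''$,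 and these restrict to anticommuting differentials of bidegrees $(0,1)$ and $(1,0)$ on $J$. 2. $J$ is acyclic: $H(J,d)=0$. 3. Consequently the canonical projection $E(n,A)\to\bar E(n,A):=E(n,A)/J$ is a quasi-isomorphism, i.e. it induces an isomorphism $H(E(n,A),d)\to H(\bar E(n,A),d)$. -/

import Mathlib

open scoped TensorProduct DirectSum

universe u v

noncomputable section

namespace GraphBicomplex

/-- A graded commutative differential graded algebra `(A, d)` over `k`, with a `ℤ`-grading and a
differential of degree `+1` (algebras graded by the natural numbers are included). -/
structure CDGA (k : Type u) [CommRing k] where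
  /-- the underlying algebra -/
  carrier : Type v
  [ring : Ring carrier]
  [algebra : Algebra k carrier]
  /-- the homogeneous components -/
  gr : ℤ → Submodule k carrier
  [graded : GradedAlgebra gr]
  /-- `a b = (-1)^{|a||b|} b a` -/
  comm : ∀ (p q : ℤ) (a b : carrier), a ∈ gr p → b ∈ gr q → a * b = (p * q).negOnePow • (b * a)
  /-- the differential -/
  d : carrier →ₗ[k] carrier
  d_mem : ∀ (p : ℤ) (a : carrier), a ∈ gr p → d a ∈ gr (p + 1)
  d_d : ∀ a : carrier, d (d a) = 0
  /-- `d (a b) = (d a) b + (-1)^{|a|} a (d b)` -/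
  leibniz : ∀ (p : ℤ) (a b : carrier), a ∈ gr p →
    d (a * b) = d a * b + p.negOnePow • (a * d b)

attribute [instance] CDGA.ring CDGA.algebra CDGA.graded

/-! ### Signs and Koszul-signed products -/

/-- The sign `(-1)^z` in `k`, for `z` an integer modulo two. -/
def sgn (k : Type u) [CommRing k] (z : ZMod 2) : k := if z = 0 then 1 else -1

theorem sgn_zero (k : Type u) [CommRing k] : sgn k 0 = 1 := by simp [sgn]

theorem sgn_one (k : Type u) [CommRing k] : sgn k 1 = -1 := by simp [sgn]

theorem zmod_two (z : ZMod 2) : z = 0 ∨ z = 1 := by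
  revert z; decide

theorem sgn_add (k : Type u) [CommRing k] (y z : ZMod 2) : sgn k (y + z) = sgn k y * sgn k z := by
  have h2 : (1 + 1 : ZMod 2) = 0 := rfl
  rcases zmod_two y with rfl | rfl <;> rcases zmod_two z with rfl | rfl <;>
    simp [sgn_zero, sgn_one, h2]

theorem sgn_mul_self (k : Type u) [CommRing k] (z : ZMod 2) : sgn k z * sgn k z = 1 := by
  rcases zmod_two z with rfl | rfl <;> simp [sgn_zero, sgn_one]

theorem sgn_sum (k : Type u) [CommRing k] {ι : Type*} (s : Finset ι) (f : ι → ZMod 2) :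
    sgn k (∑ i ∈ s, f i) = ∏ i ∈ s, sgn k (f i) := by
  classical
  induction s using Finset.induction_on with
  | empty => simp [sgn_zero]
  | insert a s ha ih => rw [Finset.sum_insert ha, Finset.prod_insert ha, sgn_add, ih]

theorem negOnePow_smul (k : Type u) [CommRing k] {M : Type*} [AddCommGroup M] [Module k M]
    (p : ℤ) (x : M) : p.negOnePow • x = sgn k (p : ZMod 2) • x := by
  rcases Int.even_or_odd p with h | h
  · have : (p : ZMod 2) = 0 := (ZMod.intCast_zmod_eq_zero_iff_dvd p 2).2 h.two_dvd
    simp [Int.negOnePow_even p h, this, sgn_zero]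
  · have : (p : ZMod 2) = 1 := by
      obtain ⟨r, rfl⟩ := h
      have h2 : (2 : ZMod 2) = 0 := rfl
      push_cast
      rw [h2]; simp
    simp [Int.negOnePow_odd p h, this, sgn_one]

/-- A grading of the `k`-algebra `B` by a finite monoid `Γ`, given by the projections onto the
homogeneous components. -/
structure ProjGrading (k : Type u) (B : Type*) (Γ : Type*) [CommRing k] [Ring B] [Algebra k B]
    [AddCommMonoid Γ] [Fintype Γ] [DecidableEq Γ] where
  /-- the projection onto the component of degree `g` -/
  proj : Γ → B →ₗ[k] B
  sum_proj : ∀ x, ∑ g, proj g x = x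
  proj_proj : ∀ g h x, proj g (proj h x) = if g = h then proj h x else 0
  proj_mul : ∀ g h x y, proj (g + h) (proj g x * proj h y) = proj g x * proj h y
  proj_one : proj 0 1 = 1

namespace ProjGrading

variable {k : Type u} [CommRing k]

section parity

variable {A : Type*} [Ring A] [Algebra k A] {ι : Type*} [AddMonoid ι] [DecidableEq ι]
  (𝒜 : ι → Submodule k A) [GradedAlgebra 𝒜] (φ : ι →+ ZMod 2)

/-- The projection of a graded algebra onto the sum of the components whose degree has a given
parity. -/
def parityProj (s : ZMod 2) : A →ₗ[k] A :=
  DirectSum.toModule k ι A (fun i => if φ i = s then (𝒜 i).subtype else 0) ∘ₗ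
    (DirectSum.decomposeLinearEquiv 𝒜).toLinearMap

theorem parityProj_of_mem (s : ZMod 2) {i : ι} {a : A} (ha : a ∈ 𝒜 i) :
    parityProj 𝒜 φ s a = if φ i = s then a else 0 := by
  lift a to 𝒜 i using ha
  simp only [parityProj, LinearMap.comp_apply, LinearEquiv.coe_coe,
    DirectSum.decomposeLinearEquiv_apply, DirectSum.decompose_coe]
  rw [← DirectSum.lof_eq_of k, DirectSum.toModule_lof]
  split_ifs <;> simp

/-- The grading of a graded algebra by the parity of the degree. -/
def parity : ProjGrading k A (ZMod 2) where
  proj := parityProj 𝒜 φ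
  sum_proj x := by
    induction x using DirectSum.Decomposition.inductionOn 𝒜 with
    | zero => simp
    | @homogeneous i m => simp [parityProj_of_mem 𝒜 φ _ m.2]
    | add x y hx hy => simp only [map_add, Finset.sum_add_distrib, hx, hy]
  proj_proj g h x := by
    induction x using DirectSum.Decomposition.inductionOn 𝒜 with
    | zero => simp
    | @homogeneous i m =>
      rw [parityProj_of_mem 𝒜 φ h m.2]
      by_cases hi : φ i = h
      · simp [hi, parityProj_of_mem 𝒜 φ _ m.2, eq_comm]
      · simp [hi]
    | add x y hx hy =>
      simp only [map_add, hx, hy]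
      split_ifs <;> simp
  proj_mul g h x y := by
    induction x using DirectSum.Decomposition.inductionOn 𝒜 with
    | zero => simp
    | @homogeneous i a =>
      induction y using DirectSum.Decomposition.inductionOn 𝒜 with
      | zero => simp
      | @homogeneous j b =>
        rw [parityProj_of_mem 𝒜 φ _ a.2, parityProj_of_mem 𝒜 φ _ b.2]
        split_ifs with h1 h2
        · rw [parityProj_of_mem 𝒜 φ _ (SetLike.mul_mem_graded a.2 b.2), if_pos]
          rw [map_add, h1, h2]
        all_goals simp
      | add x y hx hy => simp only [map_add, mul_add, hx, hy]
    | add x y hx hy => simp only [map_add, add_mul, hx, hy]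
  proj_one := by
    rw [parityProj_of_mem 𝒜 φ 0 (SetLike.GradedOne.one_mem (A := 𝒜)), if_pos (map_zero φ)]

end parity

section constructions

variable {A : Type*} [Ring A] [Algebra k A] {B : Type*} [Ring B] [Algebra k B]
  {Γ : Type*} [AddCommMonoid Γ] [Fintype Γ] [DecidableEq Γ]
  {Δ : Type*} [AddCommMonoid Δ] [Fintype Δ] [DecidableEq Δ]

/-- The multigrading of a tensor power. -/
def pi (P : ProjGrading k A Γ) (n : ℕ) :
    ProjGrading k (⨂[k] _ : Fin n, A) (Fin n → Γ) where
  proj g := PiTensorProduct.map fun i => P.proj (g i)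
  sum_proj x := by
    have h : ∑ g : Fin n → Γ, PiTensorProduct.map (R := k) (fun i => P.proj (g i)) =
        LinearMap.id := by
      have h0 := MultilinearMap.map_sum
        (PiTensorProduct.mapMultilinear k (fun _ : Fin n => A) (fun _ : Fin n => A))
        (fun (_ : Fin n) (γ : Γ) => P.proj γ)
      have h1 : (fun _ : Fin n => ∑ γ, P.proj γ) = fun _ : Fin n => LinearMap.id := by
        funext i; ext a; simp [P.sum_proj]
      rw [h1] at h0
      simp only [PiTensorProduct.mapMultilinear_apply, PiTensorProduct.map_id] at h0
      exact h0.symm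
    rw [← LinearMap.sum_apply, h, LinearMap.id_apply]
  proj_proj g h x := by
    rw [← LinearMap.comp_apply, ← PiTensorProduct.map_comp]
    split_ifs with hgh
    · subst hgh
      congr 2
      funext i; ext a; simp [P.proj_proj]
    · obtain ⟨i, hi⟩ := Function.ne_iff.1 hgh
      rw [← PiTensorProduct.mapMultilinear_apply, MultilinearMap.map_coord_zero _ i,
        LinearMap.zero_apply]
      ext a; simp [P.proj_proj, hi]
  proj_mul g h x y := by
    induction x using PiTensorProduct.induction_on with
    | smul_tprod r a =>
      induction y using PiTensorProduct.induction_on with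
      | smul_tprod s b =>
        simp only [map_smul, PiTensorProduct.map_tprod, smul_mul_assoc, mul_smul_comm,
          PiTensorProduct.tprod_mul_tprod]
        congr 4
        funext i
        simp [P.proj_mul]
      | add x y hx hy => simp only [map_add, mul_add, hx, hy]
    | add x y hx hy => simp only [map_add, add_mul, hx, hy]
  proj_one := by
    rw [PiTensorProduct.one_def, PiTensorProduct.map_tprod]
    congr 1
    funext i
    simp [P.proj_one]

/-- The bigrading of a tensor product. -/
def tensor (P : ProjGrading k A Γ) (Q : ProjGrading k B Δ) :
    ProjGrading k (A ⊗[k] B) (Γ × Δ) where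
  proj g := TensorProduct.map (P.proj g.1) (Q.proj g.2)
  sum_proj x := by
    induction x using TensorProduct.induction_on with
    | zero => simp
    | tmul a b =>
      simp only [TensorProduct.map_tmul, Fintype.sum_prod_type]
      simp only [← TensorProduct.tmul_sum, ← TensorProduct.sum_tmul, P.sum_proj, Q.sum_proj]
    | add x y hx hy => simp only [map_add, Finset.sum_add_distrib, hx, hy]
  proj_proj g h x := by
    induction x using TensorProduct.induction_on with
    | zero => simp
    | tmul a b =>
      simp only [TensorProduct.map_tmul, P.proj_proj, Q.proj_proj, Prod.ext_iff]
      split_ifs <;> simp_all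
    | add x y hx hy =>
      simp only [map_add, hx, hy]
      split_ifs <;> simp
  proj_mul g h x y := by
    induction x using TensorProduct.induction_on with
    | zero => simp
    | tmul a b =>
      induction y using TensorProduct.induction_on with
      | zero => simp
      | tmul a' b' => simp [P.proj_mul, Q.proj_mul]
      | add x y hx hy => simp only [map_add, mul_add, hx, hy]
    | add x y hx hy => simp only [map_add, add_mul, hx, hy]
  proj_one := by
    simp [Algebra.TensorProduct.one_def, P.proj_one, Q.proj_one]

end constructions

section twist

variable {B : Type*} [Ring B] [Algebra k B] {Γ : Type*} [AddCommMonoid Γ] [Fintype Γ]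
  [DecidableEq Γ] (P : ProjGrading k B Γ) (κ : Γ → Γ → ZMod 2)

/-- The product of `B` twisted by the signs `(-1)^{κ g h}`: on components of degrees `g` and `h`
it is `x, y ↦ (-1)^{κ g h} x y`. -/
def twistMul : B →ₗ[k] B →ₗ[k] B :=
  ∑ g, ∑ h, sgn k (κ g h) • (LinearMap.mul k B).compl₁₂ (P.proj g) (P.proj h)

/-- The linear map equal to `(-1)^{f g}` on the component of degree `g`. -/
def signMap (f : Γ → ZMod 2) : B →ₗ[k] B := ∑ g, sgn k (f g) • P.proj g

theorem twistMul_apply (x y : B) :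
    P.twistMul κ x y = ∑ g, ∑ h, sgn k (κ g h) • (P.proj g x * P.proj h y) := by
  simp [twistMul, LinearMap.sum_apply]

theorem twistMul_of_proj (g h : Γ) (x y : B) (hx : P.proj g x = x) (hy : P.proj h y = y) :
    P.twistMul κ x y = sgn k (κ g h) • (x * y) := by
  rw [twistMul_apply, Finset.sum_eq_single g, Finset.sum_eq_single h, hx, hy]
  · intro b _ hb
    rw [← hy, P.proj_proj, if_neg hb, mul_zero, smul_zero]
  · simp
  · intro b _ hb
    rw [← hx, P.proj_proj, if_neg hb]
    simp
  · simp

theorem signMap_of_proj (f : Γ → ZMod 2) (g : Γ) (x : B) (hx : P.proj g x = x) :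
    P.signMap f x = sgn k (f g) • x := by
  simp only [signMap, LinearMap.sum_apply, LinearMap.smul_apply]
  rw [Finset.sum_eq_single g, hx]
  · intro b _ hb
    rw [← hx, P.proj_proj, if_neg hb, smul_zero]
  · simp

theorem proj_idem (g : Γ) (x : B) : P.proj g (P.proj g x) = P.proj g x := by
  rw [P.proj_proj, if_pos rfl]

theorem ext_proj {M : Type*} [AddCommGroup M] [Module k M] {f f' : B →ₗ[k] M}
    (h : ∀ g x, P.proj g x = x → f x = f' x) : f = f' := by
  ext x
  rw [← P.sum_proj x, map_sum, map_sum]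
  exact Finset.sum_congr rfl fun g _ => h g _ (P.proj_idem g x)

theorem mul_proj {g h : Γ} {x y : B} (hx : P.proj g x = x) (hy : P.proj h y = y) :
    P.proj (g + h) (x * y) = x * y := by
  rw [← hx, ← hy, P.proj_mul]

theorem twistMul_assoc (hl : ∀ a b c, κ (a + b) c = κ a c + κ b c)
    (hr : ∀ a b c, κ a (b + c) = κ a b + κ a c) (x y z : B) :
    P.twistMul κ (P.twistMul κ x y) z = P.twistMul κ x (P.twistMul κ y z) := by
  rw [← P.sum_proj x, ← P.sum_proj y, ← P.sum_proj z]
  simp only [map_sum, LinearMap.sum_apply]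
  refine Finset.sum_congr rfl fun c _ => Finset.sum_congr rfl fun b _ =>
    Finset.sum_congr rfl fun a _ => ?_
  have ha := P.proj_idem a x
  have hb := P.proj_idem b y
  have hc := P.proj_idem c z
  rw [P.twistMul_of_proj κ a b _ _ ha hb, P.twistMul_of_proj κ b c _ _ hb hc, map_smul, map_smul,
    LinearMap.smul_apply, P.twistMul_of_proj κ (a + b) c _ _ (P.mul_proj ha hb) hc,
    P.twistMul_of_proj κ a (b + c) _ _ ha (P.mul_proj hb hc), hl, hr, sgn_add, sgn_add, smul_smul,
    smul_smul, mul_assoc (P.proj a x)]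
  congr 1
  ring

theorem twistMul_one_left (h0 : ∀ b, κ 0 b = 0) (x : B) : P.twistMul κ 1 x = x := by
  rw [twistMul_apply, Finset.sum_eq_single 0]
  · simp [h0, sgn_zero, P.proj_one, P.sum_proj]
  · intro b _ hb
    rw [← P.proj_one, P.proj_proj, if_neg hb]
    simp
  · simp

theorem twistMul_one_right (h0 : ∀ b, κ b 0 = 0) (x : B) : P.twistMul κ x 1 = x := by
  rw [twistMul_apply, Finset.sum_comm, Finset.sum_eq_single 0]
  · simp [h0, sgn_zero, P.proj_one, P.sum_proj]
  · intro b _ hb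
    rw [← P.proj_one, P.proj_proj, if_neg hb]
    simp
  · simp

theorem signMap_mul (f : Γ → ZMod 2) (hf : ∀ a b, f (a + b) = f a + f b) (x y : B) :
    P.signMap f (P.twistMul κ x y) = P.twistMul κ (P.signMap f x) (P.signMap f y) := by
  rw [← P.sum_proj x, ← P.sum_proj y]
  simp only [map_sum, LinearMap.sum_apply]
  refine Finset.sum_congr rfl fun b _ => Finset.sum_congr rfl fun a _ => ?_
  have ha := P.proj_idem a x
  have hb := P.proj_idem b y
  rw [P.signMap_of_proj f a _ ha, P.signMap_of_proj f b _ hb, P.twistMul_of_proj κ a b _ _ ha hb]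
  simp only [map_smul, LinearMap.smul_apply]
  rw [P.signMap_of_proj f (a + b) _ (P.mul_proj ha hb), P.twistMul_of_proj κ a b _ _ ha hb, hf,
    sgn_add]
  simp only [smul_smul]
  congr 1
  ring

/-- A map `D` of degree `δ` which satisfies a signed Leibniz rule for the product of `B` is a
derivation for the twisted product, if the signs fit together. -/
theorem leibniz_twistMul (D : B →ₗ[k] B) (δ : Γ) (f ε₁ ε₂ : Γ → ZMod 2)
    (hl : ∀ a b, κ (a + δ) b = κ a b + ε₁ b)
    (hr : ∀ a b, κ a b + ε₂ a = f a + κ a (b + δ))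
    (hD : ∀ g x, P.proj g x = x → P.proj (g + δ) (D x) = D x)
    (hmul : ∀ g h x y, P.proj g x = x → P.proj h y = y →
      D (x * y) = sgn k (ε₁ h) • (D x * y) + sgn k (ε₂ g) • (x * D y)) (x y : B) :
    D (P.twistMul κ x y) = P.twistMul κ (D x) y + P.twistMul κ (P.signMap f x) (D y) := by
  rw [← P.sum_proj x, ← P.sum_proj y]
  simp only [map_sum, LinearMap.sum_apply, ← Finset.sum_add_distrib]
  refine Finset.sum_congr rfl fun b _ => Finset.sum_congr rfl fun a _ => ?_
  have ha := P.proj_idem a x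
  have hb := P.proj_idem b y
  rw [P.signMap_of_proj f a _ ha, P.twistMul_of_proj κ a b _ _ ha hb]
  simp only [map_smul, LinearMap.smul_apply]
  rw [hmul a b _ _ ha hb, P.twistMul_of_proj κ (a + δ) b _ _ (hD a _ ha) hb,
    P.twistMul_of_proj κ a (b + δ) _ _ ha (hD b _ hb), hl, smul_add, smul_smul, smul_smul,
    smul_smul, ← sgn_add, ← sgn_add, hr, sgn_add k (f a)]

end twist

end ProjGrading

/-! ### The algebra `A^{⊗n} ⊗ Λ(e_ij)` -/

section pre

variable {k : Type u} [CommRing k]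

namespace CDGA

variable (A : CDGA.{u, v} k)

/-- The grading of `A` by the parity of the degree. -/
def par : ProjGrading k A.carrier (ZMod 2) :=
  ProjGrading.parity A.gr (Int.castAddHom (ZMod 2))

/-- The involution `a ↦ (-1)^{|a|} a` of `A`. -/
def invol : A.carrier →ₗ[k] A.carrier := A.par.signMap id

theorem par_of_mem (s : ZMod 2) {p : ℤ} {a : A.carrier} (ha : a ∈ A.gr p) :
    A.par.proj s a = if (p : ZMod 2) = s then a else 0 :=
  ProjGrading.parityProj_of_mem A.gr (Int.castAddHom (ZMod 2)) s ha

theorem d_one : A.d 1 = 0 := by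
  have h := A.leibniz 0 1 1 (SetLike.GradedOne.one_mem (A := A.gr))
  simpa using h

theorem leibniz_par (s : ZMod 2) (a b : A.carrier) (ha : A.par.proj s a = a) :
    A.d (a * b) = A.d a * b + sgn k s • (a * A.d b) := by
  rw [← ha]
  generalize a = x
  induction x using DirectSum.Decomposition.inductionOn A.gr with
  | zero => simp
  | @homogeneous i m =>
    rw [A.par_of_mem s m.2]
    split_ifs with h
    · rw [A.leibniz i _ _ m.2, negOnePow_smul k, h]
    · simp
  | add x y hx hy =>
    simp only [map_add, add_mul, hx, hy, smul_add]
    abel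

theorem par_d (s : ZMod 2) (a : A.carrier) (ha : A.par.proj s a = a) :
    A.par.proj (s + 1) (A.d a) = A.d a := by
  rw [← ha]
  generalize a = x
  induction x using DirectSum.Decomposition.inductionOn A.gr with
  | zero => simp
  | @homogeneous i m =>
    rw [A.par_of_mem s m.2]
    split_ifs with h
    · rw [A.par_of_mem _ (A.d_mem i _ m.2), if_pos]
      rw [← h]; push_cast; rfl
    · simp
  | add x y hx hy => simp only [map_add, hx, hy]

theorem invol_of_par (s : ZMod 2) (a : A.carrier) (ha : A.par.proj s a = a) :
    A.invol a = sgn k s • a :=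
  A.par.signMap_of_proj id s a ha

theorem invol_invol : A.invol ∘ₗ A.invol = LinearMap.id := by
  refine A.par.ext_proj fun s a ha => ?_
  rw [LinearMap.comp_apply, A.invol_of_par s a ha, map_smul, A.invol_of_par s a ha, smul_smul,
    sgn_mul_self, one_smul, LinearMap.id_apply]

theorem d_invol : A.d ∘ₗ A.invol = -(A.invol ∘ₗ A.d) := by
  refine A.par.ext_proj fun s a ha => ?_
  rw [LinearMap.comp_apply, LinearMap.neg_apply, LinearMap.comp_apply, A.invol_of_par s a ha,
    A.invol_of_par _ _ (A.par_d s a ha), map_smul, sgn_add, sgn_one]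
  simp

end CDGA

/-- The edges `(i, j)`, `i < j`, on `n` vertices. -/
abbrev Edge (n : ℕ) : Type := {e : Fin n × Fin n // e.1 < e.2}

/-- The exterior algebra on the generators `e_ij`, `i < j`. -/
abbrev EdgeAlg (k : Type u) [CommRing k] (n : ℕ) : Type u := ExteriorAlgebra k (Edge n →₀ k)

/-- The grading of the exterior algebra by the parity of the degree. -/
def edgePar (k : Type u) [CommRing k] (n : ℕ) : ProjGrading k (EdgeAlg k n) (ZMod 2) :=
  ProjGrading.parity (fun q : ℕ => ⋀[k]^q (Edge n →₀ k)) (Nat.castAddMonoidHom (ZMod 2))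

variable (A : CDGA.{u, v} k) (n : ℕ)

/-- The underlying module of `A^{⊗n} ⊗ Λ(e_ij)`. -/
abbrev PreModule : Type (max u v) := (⨂[k] _ : Fin n, A.carrier) ⊗[k] EdgeAlg k n

/-- The grading of `A^{⊗n} ⊗ Λ(e_ij)` by the parities of the `n + 1` tensor factors. -/
def prePar : ProjGrading k (PreModule A n) ((Fin n → ZMod 2) × ZMod 2) :=
  (A.par.pi n).tensor (edgePar k n)

/-- The exponent of the sign produced in `(a₁ ⊗ ⋯ ⊗ aₙ ⊗ x) (b₁ ⊗ ⋯ ⊗ bₙ ⊗ y)` by moving each `b_j`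
past `x` and past the `a_i` with `i > j`; here `g` and `h` are the degrees of the factors. -/
def koszul (g h : (Fin n → ZMod 2) × ZMod 2) : ZMod 2 :=
  (∑ j, ∑ i, if j < i then g.1 i * h.1 j else 0) + g.2 * ∑ j, h.1 j

/-- The graded algebra `A^{⊗n} ⊗ Λ(e_ij)`. -/
def Pre : Type (max u v) := PreModule A n

instance : AddCommGroup (Pre A n) := inferInstanceAs (AddCommGroup (PreModule A n))

instance : Module k (Pre A n) := inferInstanceAs (Module k (PreModule A n))

/-- The multiplication of `A^{⊗n} ⊗ Λ(e_ij)`, with the Koszul signs. -/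
def preMul : Pre A n →ₗ[k] Pre A n →ₗ[k] Pre A n := (prePar A n).twistMul (koszul n)

variable {n} in
theorem koszul_add_left (a b c : (Fin n → ZMod 2) × ZMod 2) :
    koszul n (a + b) c = koszul n a c + koszul n b c := by
  have : ∀ i j : Fin n, (if j < i then (a.1 i + b.1 i) * c.1 j else 0) =
      (if j < i then a.1 i * c.1 j else 0) + if j < i then b.1 i * c.1 j else 0 := by
    intro i j; split_ifs <;> ring
  simp only [koszul, Prod.fst_add, Prod.snd_add, Pi.add_apply, this, Finset.sum_add_distrib]
  ring

variable {n} in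
theorem koszul_add_right (a b c : (Fin n → ZMod 2) × ZMod 2) :
    koszul n a (b + c) = koszul n a b + koszul n a c := by
  have : ∀ i j : Fin n, (if j < i then a.1 i * (b.1 j + c.1 j) else 0) =
      (if j < i then a.1 i * b.1 j else 0) + if j < i then a.1 i * c.1 j else 0 := by
    intro i j; split_ifs <;> ring
  simp only [koszul, Prod.fst_add, Pi.add_apply, this, Finset.sum_add_distrib]
  ring

instance : Ring (Pre A n) :=
  { (inferInstance : AddCommGroup (Pre A n)) with
    mul := fun x y => preMul A n x y
    one := (1 : PreModule A n)
    left_distrib := fun x y z => map_add (preMul A n x) y z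
    right_distrib := fun x y z => LinearMap.map_add₂ (preMul A n) x y z
    zero_mul := fun x => LinearMap.map_zero₂ (preMul A n) x
    mul_zero := fun x => map_zero (preMul A n x)
    mul_assoc := (prePar A n).twistMul_assoc _ koszul_add_left koszul_add_right
    one_mul := (prePar A n).twistMul_one_left _ fun b => by simp [koszul]
    mul_one := (prePar A n).twistMul_one_right _ fun b => by simp [koszul] }

theorem pre_mul_def (x y : Pre A n) : x * y = preMul A n x y := rfl

instance : Algebra k (Pre A n) :=
  Algebra.ofModule (fun r x y => LinearMap.map_smul₂ (preMul A n) r x y)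
    (fun r x y => map_smul (preMul A n x) r y)

/-- The element `(a₁ ⊗ ⋯ ⊗ aₙ) ⊗ x` of `A^{⊗n} ⊗ Λ(e_ij)`. -/
def Pre.mk {n : ℕ} (a : Fin n → A.carrier) (x : EdgeAlg k n) : Pre A n :=
  (PiTensorProduct.tprod k a ⊗ₜ[k] x : PreModule A n)

/-- The product of homogeneous elements:
`((⊗ᵢ aᵢ) ⊗ x) ((⊗ᵢ bᵢ) ⊗ y) = ± (⊗ᵢ aᵢ bᵢ) ⊗ x y`, with the Koszul sign. -/
theorem Pre.mk_mul_mk {n : ℕ} (p q : Fin n → ℤ) (s t : ℕ) (a b : Fin n → A.carrier)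
    (x y : EdgeAlg k n) (ha : ∀ i, a i ∈ A.gr (p i)) (hb : ∀ i, b i ∈ A.gr (q i))
    (hx : x ∈ ⋀[k]^s (Edge n →₀ k)) (hy : y ∈ ⋀[k]^t (Edge n →₀ k)) :
    Pre.mk A a x * Pre.mk A b y =
      ((∑ j, ∑ i, if j < i then p i * q j else 0) + s * ∑ j, q j).negOnePow •
        Pre.mk A (fun i => a i * b i) (x * y) := by
  have key : ∀ (p : Fin n → ℤ) (s : ℕ) (a : Fin n → A.carrier) (x : EdgeAlg k n),
      (∀ i, a i ∈ A.gr (p i)) → x ∈ ⋀[k]^s (Edge n →₀ k) →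
      (prePar A n).proj (fun i => (p i : ZMod 2), (s : ZMod 2)) (Pre.mk A a x) = Pre.mk A a x := by
    intro p s a x ha hx
    change TensorProduct.map (PiTensorProduct.map fun i => A.par.proj (p i : ZMod 2))
      ((edgePar k n).proj (s : ZMod 2)) (PiTensorProduct.tprod k a ⊗ₜ[k] x) = _
    rw [TensorProduct.map_tmul, PiTensorProduct.map_tprod]
    congr 2
    · funext i
      rw [A.par_of_mem _ (ha i), if_pos rfl]
    · exact (ProjGrading.parityProj_of_mem (fun q : ℕ => ⋀[k]^q (Edge n →₀ k))
        (Nat.castAddMonoidHom (ZMod 2)) _ hx).trans (if_pos rfl)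
  refine ((prePar A n).twistMul_of_proj (koszul n) _ _ (Pre.mk A a x) (Pre.mk A b y)
    (key p s a x ha hx) (key q t b y hb hy)).trans ?_
  rw [negOnePow_smul k]
  have h1 : koszul n (fun i => (p i : ZMod 2), (s : ZMod 2)) (fun i => (q i : ZMod 2), (t : ZMod 2)) =
      (((∑ j, ∑ i, if j < i then p i * q j else 0) + s * ∑ j, q j : ℤ) : ZMod 2) := by
    simp only [koszul]
    push_cast
    simp
  rw [h1]
  refine congrArg (fun z : Pre A n => sgn k _ • z) ?_
  exact (Algebra.TensorProduct.tmul_mul_tmul _ _ _ _).trans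
    (congrArg (· ⊗ₜ[k] (x * y)) (PiTensorProduct.tprod_mul_tprod _ _))

/-! ### The differentials on `A^{⊗n} ⊗ Λ(e_ij)` -/

/-- The factors of the map
`a₁ ⊗ ⋯ ⊗ aₙ ↦ (-1)^{|a₁| + ⋯ + |a_{i-1}|} a₁ ⊗ ⋯ ⊗ d aᵢ ⊗ ⋯ ⊗ aₙ`. -/
def dFactor {n : ℕ} (i j : Fin n) : A.carrier →ₗ[k] A.carrier :=
  if j < i then A.invol else if j = i then A.d else LinearMap.id

/-- The differential of the tensor power `A^{⊗n}`. -/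
def dPow : (⨂[k] _ : Fin n, A.carrier) →ₗ[k] ⨂[k] _ : Fin n, A.carrier :=
  ∑ i : Fin n, PiTensorProduct.map (dFactor A i)

/-- The differential `d''` of `A^{⊗n} ⊗ Λ(e_ij)`: the differential of `A^{⊗n}`, with `d'' e_ij = 0`. -/
def dPre : Pre A n →ₗ[k] Pre A n := LinearMap.rTensor (EdgeAlg k n) (dPow A n)

/-- The involution `x ↦ (-1)^{|x|} x` for the total degree. -/
def involPre : Pre A n →ₗ[k] Pre A n := (prePar A n).signMap fun g => (∑ i, g.1 i) + g.2

theorem involPre_mul (x y : Pre A n) :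
    involPre A n (x * y) = involPre A n x * involPre A n y := by
  refine (prePar A n).signMap_mul (koszul n) _ (fun a b => ?_) x y
  simp only [Prod.fst_add, Prod.snd_add, Pi.add_apply, Finset.sum_add_distrib]
  ring

/-- One summand of `dPre`. -/
def dPreAt (i : Fin n) : PreModule A n →ₗ[k] PreModule A n :=
  LinearMap.rTensor (EdgeAlg k n) (PiTensorProduct.map (dFactor A i))

theorem dPre_apply (x : Pre A n) : dPre A n x = ∑ i, dPreAt A n i x := by
  have : (LinearMap.rTensor (EdgeAlg k n) (dPow A n) : PreModule A n →ₗ[k] PreModule A n) =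
      ∑ i, dPreAt A n i := by
    unfold dPow dPreAt
    exact map_sum (LinearMap.rTensorHom (EdgeAlg k n)) _ _
  exact (LinearMap.congr_fun this x).trans (LinearMap.sum_apply _ _ _)

theorem dPreAt_leibniz (i : Fin n) (g h : (Fin n → ZMod 2) × ZMod 2) (x y : PreModule A n)
    (hx : (prePar A n).proj g x = x) (hy : (prePar A n).proj h y = y) :
    dPreAt A n i (x * y) = sgn k (∑ j, if j < i then h.1 j else 0) • (dPreAt A n i x * y) +
      sgn k (∑ j, if j ≤ i then g.1 j else 0) • (x * dPreAt A n i y) := by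
  rw [← hx, ← hy]
  generalize x = x
  generalize y = y
  induction x using TensorProduct.induction_on with
  | zero => simp
  | add x x' ihx ihx' =>
    simp only [map_add, add_mul, ihx, ihx', smul_add]
    abel
  | tmul α l =>
  induction y using TensorProduct.induction_on with
  | zero => simp
  | add y y' ihy ihy' =>
    simp only [map_add, mul_add, ihy, ihy', smul_add]
    abel
  | tmul β m =>
  induction α using PiTensorProduct.induction_on with
  | add x x' ihx ihx' =>
    simp only [map_add, TensorProduct.add_tmul, add_mul, ihx, ihx', smul_add]
    abel
  | smul_tprod r a =>
  induction β using PiTensorProduct.induction_on with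
  | add y y' ihy ihy' =>
    simp only [map_add, TensorProduct.add_tmul, mul_add, ihy, ihy', smul_add]
    abel
  | smul_tprod s b =>
  change dPreAt A n i (TensorProduct.map (PiTensorProduct.map fun i => A.par.proj (g.1 i))
      ((edgePar k n).proj g.2) ((r • PiTensorProduct.tprod k a) ⊗ₜ[k] l) *
      TensorProduct.map (PiTensorProduct.map fun i => A.par.proj (h.1 i))
      ((edgePar k n).proj h.2) ((s • PiTensorProduct.tprod k b) ⊗ₜ[k] m)) =
    sgn k _ • (dPreAt A n i (TensorProduct.map (PiTensorProduct.map fun i => A.par.proj (g.1 i))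
      ((edgePar k n).proj g.2) ((r • PiTensorProduct.tprod k a) ⊗ₜ[k] l)) *
      TensorProduct.map (PiTensorProduct.map fun i => A.par.proj (h.1 i))
      ((edgePar k n).proj h.2) ((s • PiTensorProduct.tprod k b) ⊗ₜ[k] m)) +
    sgn k _ • (TensorProduct.map (PiTensorProduct.map fun i => A.par.proj (g.1 i))
      ((edgePar k n).proj g.2) ((r • PiTensorProduct.tprod k a) ⊗ₜ[k] l) *
      dPreAt A n i (TensorProduct.map (PiTensorProduct.map fun i => A.par.proj (h.1 i))
      ((edgePar k n).proj h.2) ((s • PiTensorProduct.tprod k b) ⊗ₜ[k] m)))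
  simp only [TensorProduct.map_tmul, map_smul, PiTensorProduct.map_tprod,
    Algebra.TensorProduct.tmul_mul_tmul, smul_mul_assoc, mul_smul_comm,
    PiTensorProduct.tprod_mul_tprod, dPreAt, LinearMap.rTensor_tmul]
  set a' : Fin n → A.carrier := fun j => A.par.proj (g.1 j) (a j) with ha'
  set b' : Fin n → A.carrier := fun j => A.par.proj (h.1 j) (b j) with hb'
  have ha : ∀ j, A.par.proj (g.1 j) (a' j) = a' j := fun j => A.par.proj_idem _ _
  have hb : ∀ j, A.par.proj (h.1 j) (b' j) = b' j := fun j => A.par.proj_idem _ _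
  set L := (edgePar k n).proj g.2 l * (edgePar k n).proj h.2 m
  -- the three families of factors
  set F₁ : Fin n → A.carrier := (fun j => dFactor A i j (a' j)) * b' with hF₁
  set F₂ : Fin n → A.carrier := a' * (fun j => dFactor A i j (b' j)) with hF₂
  have key : PiTensorProduct.tprod k (fun j => dFactor A i j ((a' * b') j)) =
      sgn k (∑ j, if j < i then h.1 j else 0) • PiTensorProduct.tprod k F₁ +
      sgn k (∑ j, if j ≤ i then g.1 j else 0) • PiTensorProduct.tprod k F₂ := by
    set G₁ : Fin n → A.carrier := fun j => sgn k (if j < i then h.1 j else 0) • F₁ j with hG₁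
    set G₂ : Fin n → A.carrier := fun j => sgn k (if j ≤ i then g.1 j else 0) • F₂ j with hG₂
    have e1 : PiTensorProduct.tprod k G₁ =
        sgn k (∑ j, if j < i then h.1 j else 0) • PiTensorProduct.tprod k F₁ := by
      rw [sgn_sum, hG₁, MultilinearMap.map_smul_univ]
    have e2 : PiTensorProduct.tprod k G₂ =
        sgn k (∑ j, if j ≤ i then g.1 j else 0) • PiTensorProduct.tprod k F₂ := by
      rw [sgn_sum, hG₂, MultilinearMap.map_smul_univ]
    have hinv : ∀ j, A.invol (a' j * b' j) = sgn k (g.1 j) • sgn k (h.1 j) • (a' j * b' j) := by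
      intro j
      rw [A.invol_of_par (g.1 j + h.1 j) _ (A.par.mul_proj (ha j) (hb j)), sgn_add, smul_smul]
    have h12 : Function.update G₁ i (G₂ i) = G₂ := by
      funext j
      by_cases hj : j = i
      · subst hj; simp
      · rw [Function.update_of_ne hj]
        by_cases hlt : j < i
        · simp only [hG₁, hG₂, hF₁, hF₂, dFactor, Pi.mul_apply, hlt, hlt.le, if_true]
          rw [A.invol_of_par _ _ (ha j), A.invol_of_par _ _ (hb j), smul_mul_assoc, mul_smul_comm,
            smul_comm]
        · have hle : ¬ j ≤ i := fun hle => hlt (lt_of_le_of_ne hle hj)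
          simp [hG₁, hG₂, hF₁, hF₂, dFactor, hlt, hle, hj]
    have h3 : (fun j => dFactor A i j ((a' * b') j)) = Function.update G₁ i (G₁ i + G₂ i) := by
      funext j
      by_cases hj : j = i
      · subst hj
        simp only [Function.update_self, hG₁, hG₂, hF₁, hF₂, dFactor, Pi.mul_apply, lt_irrefl,
          le_refl, if_true, if_false, sgn_zero, one_smul]
        exact A.leibniz_par _ _ _ (ha j)
      · rw [Function.update_of_ne hj]
        by_cases hlt : j < i
        · simp only [hG₁, hF₁, dFactor, Pi.mul_apply, hlt, if_true]
          rw [hinv, A.invol_of_par _ _ (ha j), smul_mul_assoc, smul_comm]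
        · simp [hG₁, hF₁, dFactor, hlt, hj, sgn_zero]
    rw [h3, MultilinearMap.map_update_add, Function.update_eq_self, h12, e1, e2]
  rw [key]
  simp only [TensorProduct.add_tmul, TensorProduct.smul_tmul', smul_add, smul_smul,
    TensorProduct.smul_tmul]
  congr 1 <;> congr 1 <;> ring_nf

variable {n} in
theorem prePar_tmul (g : (Fin n → ZMod 2) × ZMod 2) (a : Fin n → A.carrier) (x : EdgeAlg k n) :
    (prePar A n).proj g (PiTensorProduct.tprod k a ⊗ₜ[k] x) =
      PiTensorProduct.tprod k (fun i => A.par.proj (g.1 i) (a i)) ⊗ₜ[k]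
        (edgePar k n).proj g.2 x :=
  (TensorProduct.map_tmul _ _ _ _).trans
    (congrArg (· ⊗ₜ[k] (edgePar k n).proj g.2 x) (PiTensorProduct.map_tprod _ _))

variable {n} in
theorem dPreAt_tmul (i : Fin n) (a : Fin n → A.carrier) (x : EdgeAlg k n) :
    dPreAt A n i (PiTensorProduct.tprod k a ⊗ₜ[k] x) =
      PiTensorProduct.tprod k (fun j => dFactor A i j (a j)) ⊗ₜ[k] x :=
  (LinearMap.rTensor_tmul _ _ _ _).trans
    (congrArg (· ⊗ₜ[k] x) (PiTensorProduct.map_tprod _ _))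

theorem dPreAt_proj (i : Fin n) (g : (Fin n → ZMod 2) × ZMod 2) (x : PreModule A n)
    (hx : (prePar A n).proj g x = x) :
    (prePar A n).proj (g + (Pi.single i 1, 0)) (dPreAt A n i x) = dPreAt A n i x := by
  rw [← hx]
  generalize x = x
  induction x using TensorProduct.induction_on with
  | zero => simp
  | add x x' ihx ihx' => simp only [map_add, ihx, ihx']
  | tmul α l =>
  induction α using PiTensorProduct.induction_on with
  | add x x' ihx ihx' => simp only [map_add, TensorProduct.add_tmul, ihx, ihx']
  | smul_tprod r a =>
  rw [← TensorProduct.smul_tmul', map_smul, map_smul, map_smul, prePar_tmul, dPreAt_tmul,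
    prePar_tmul]
  congr 2
  · congr 1
    funext j
    by_cases hj : j = i
    · subst hj
      simpa [dFactor] using A.par_d _ _ (A.par.proj_idem (g.1 j) (a j))
    · have h0 : (g.1 + (Pi.single i 1 : Fin n → ZMod 2)) j = g.1 j := by simp [hj]
      rw [Prod.fst_add, h0]
      by_cases hlt : j < i
      · simp only [dFactor, hlt, if_true]
        rw [A.invol_of_par _ _ (A.par.proj_idem (g.1 j) (a j)), map_smul, A.par.proj_idem]
      · simp [dFactor, hlt, hj, A.par.proj_idem]
  · rw [Prod.snd_add, add_zero, (edgePar k n).proj_idem]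

theorem zmod_two_add_self (z : ZMod 2) : z + z = 0 := by
  rcases zmod_two z with rfl | rfl <;> rfl

/-- `d'' (x y) = (d'' x) y + (-1)^{|x|} x (d'' y)`. -/
theorem dPre_mul (x y : Pre A n) :
    dPre A n (x * y) = dPre A n x * y + involPre A n x * dPre A n y := by
  have h : ∀ i, dPreAt A n i (preMul A n x y) =
      preMul A n (dPreAt A n i x) y + preMul A n (involPre A n x) (dPreAt A n i y) := by
    intro i
    refine (prePar A n).leibniz_twistMul (koszul n) (dPreAt A n i) (Pi.single i 1, 0)
      (fun g => (∑ i, g.1 i) + g.2) (fun h => ∑ j, if j < i then h.1 j else 0)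
      (fun g => ∑ j, if j ≤ i then g.1 j else 0) ?_ ?_ (dPreAt_proj A n i)
      (dPreAt_leibniz A n i) x y
    · intro a b
      rw [koszul_add_left]
      congr 1
      simp only [koszul, zero_mul, add_zero]
      refine Finset.sum_congr rfl fun j _ => ?_
      rw [Finset.sum_eq_single i]
      · simp
      · intro l _ hl; simp [hl]
      · simp
    · intro a b
      rw [koszul_add_right]
      have h1 : koszul n a (Pi.single i 1, 0) = (∑ j, if j ≤ i then 0 else a.1 j) + a.2 := by
        simp only [koszul]
        rw [Finset.sum_eq_single i]
        · simp only [Pi.single_eq_same, mul_one, Finset.sum_pi_single', Finset.mem_univ, if_true]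
          congr 1
          refine Finset.sum_congr rfl fun j _ => ?_
          by_cases hj : j ≤ i
          · simp [hj, not_lt.2 hj]
          · simp [hj, not_le.1 hj]
        · intro l _ hl; simp [hl]
        · simp
      have h2 : ∑ j, a.1 j = (∑ j, if j ≤ i then a.1 j else 0) + ∑ j, if j ≤ i then 0 else a.1 j := by
        rw [← Finset.sum_add_distrib]
        refine Finset.sum_congr rfl fun j _ => ?_
        split_ifs <;> simp
      rw [h1, h2]
      have h3 := zmod_two_add_self a.2
      have h4 := zmod_two_add_self (∑ j, if j ≤ i then 0 else a.1 j)
      linear_combination (-h3 - h4)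
  rw [dPre_apply A n x, dPre_apply A n y]
  refine (dPre_apply A n _).trans ((Finset.sum_congr rfl fun i _ => h i).trans ?_)
  refine Finset.sum_add_distrib.trans ?_
  exact congrArg₂ (· + ·) ((map_sum ((preMul A n).flip y) _ _).symm)
    ((map_sum (preMul A n (involPre A n x)) _ _).symm)

theorem dFactor_comp_self {n : ℕ} (i : Fin n) :
    PiTensorProduct.map (dFactor A i) ∘ₗ PiTensorProduct.map (dFactor A i) = 0 := by
  rw [← PiTensorProduct.map_comp, ← PiTensorProduct.mapMultilinear_apply,
    MultilinearMap.map_coord_zero _ i]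
  ext a
  simp [dFactor, A.d_d]

theorem dFactor_anticomm {n : ℕ} {i j : Fin n} (hij : i < j) :
    PiTensorProduct.map (dFactor A i) ∘ₗ PiTensorProduct.map (dFactor A j) +
      PiTensorProduct.map (dFactor A j) ∘ₗ PiTensorProduct.map (dFactor A i) = 0 := by
  rw [← PiTensorProduct.map_comp, ← PiTensorProduct.map_comp]
  have h : (fun l => dFactor A j l ∘ₗ dFactor A i l) =
      Function.update (fun l => dFactor A i l ∘ₗ dFactor A j l) i
        ((-1 : k) • (dFactor A i i ∘ₗ dFactor A j i)) := by
    funext l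
    rcases lt_trichotomy l i with hl | rfl | hl
    · rw [Function.update_of_ne hl.ne]
      simp [dFactor, hl, hl.trans hij]
    · rw [Function.update_self]
      simp [dFactor, hij, A.d_invol]
    · rw [Function.update_of_ne hl.ne']
      ext a
      by_cases hlj : l < j <;> by_cases hlj' : l = j <;>
        simp [dFactor, hl.not_gt, hl.ne', hlj, hlj', hij.not_gt, hij.ne']
  rw [h, PiTensorProduct.map_update_smul, Function.update_eq_self]
  refine LinearMap.ext fun x => ?_
  exact (congrArg (_ + ·) (neg_one_smul k _)).trans (add_neg_cancel _)

theorem dPow_comp_self : dPow A n ∘ₗ dPow A n = 0 := by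
  change dPow A n * dPow A n = 0
  rw [dPow, Finset.sum_mul_sum, ← Finset.sum_product']
  refine Finset.sum_involution (fun x _ => x.swap) ?_ ?_ (by simp) (by simp)
  · rintro ⟨i, j⟩ _
    rcases lt_trichotomy i j with h | rfl | h
    · exact dFactor_anticomm A h
    · exact (congrArg₂ (· + ·) (dFactor_comp_self A i) (dFactor_comp_self A i)).trans (add_zero _)
    · exact (add_comm _ _).trans (dFactor_anticomm A h)
  · rintro ⟨i, j⟩ _ h he
    obtain rfl : j = i := congrArg Prod.fst he
    exact h (dFactor_comp_self A j)

theorem dPre_dPre (x : Pre A n) : dPre A n (dPre A n x) = 0 := by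
  have h : (LinearMap.rTensor (EdgeAlg k n) (dPow A n)) ∘ₗ
      (LinearMap.rTensor (EdgeAlg k n) (dPow A n)) = 0 := by
    rw [← LinearMap.rTensor_comp, dPow_comp_self, LinearMap.rTensor_zero]
  exact LinearMap.congr_fun h x

variable {n}

/-- The element `e_i(a) = 1 ⊗ ⋯ ⊗ a ⊗ ⋯ ⊗ 1`, with `a` in position `i`. -/
def Pre.inc (i : Fin n) (a : A.carrier) : Pre A n := Pre.mk A (Pi.mulSingle i a) 1

/-- The generator `e_ij`. -/
def Pre.edge (e : Edge n) : Pre A n :=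
  Pre.mk A (fun _ => 1) (ExteriorAlgebra.ι k (Finsupp.single e 1))

theorem Pre.inc_add (i : Fin n) (a b : A.carrier) :
    Pre.inc A i (a + b) = Pre.inc A i a + Pre.inc A i b :=
  (congrArg (· ⊗ₜ[k] (1 : EdgeAlg k n))
    ((PiTensorProduct.tprod k).map_update_add (1 : Fin n → A.carrier) i a b)).trans
    (TensorProduct.add_tmul _ _ _)

theorem Pre.inc_smul (i : Fin n) (r : k) (a : A.carrier) :
    Pre.inc A i (r • a) = r • Pre.inc A i a :=
  (congrArg (· ⊗ₜ[k] (1 : EdgeAlg k n))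
    ((PiTensorProduct.tprod k).map_update_smul (1 : Fin n → A.carrier) i r a)).trans
    (TensorProduct.smul_tmul' _ _ _).symm

theorem Pre.inc_zero (i : Fin n) : Pre.inc A i 0 = 0 := by
  simpa using Pre.inc_smul A i (0 : k) 0

theorem invol_one : A.invol 1 = 1 := by
  rw [A.invol_of_par 0 1 A.par.proj_one, sgn_zero, one_smul]

theorem dPre_inc (i : Fin n) (a : A.carrier) :
    dPre A n (Pre.inc A i a) = Pre.inc A i (A.d a) := by
  rw [dPre_apply, Finset.sum_eq_single i]
  · refine (LinearMap.rTensor_tmul _ _ _ _).trans ?_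
    refine congrArg (· ⊗ₜ[k] (1 : EdgeAlg k n)) ?_
    rw [PiTensorProduct.map_tprod]
    congr 1
    funext j
    by_cases hj : j = i
    · subst hj; simp [dFactor]
    · by_cases hlt : j < i
      · simp [dFactor, hlt, hj, invol_one]
      · simp [dFactor, hlt, hj]
  · intro l _ hl
    refine (dPreAt_tmul A l _ _).trans ?_
    rw [MultilinearMap.map_coord_zero _ l (by simp [dFactor, hl, A.d_one]),
      TensorProduct.zero_tmul]
  · simp

theorem dPre_edge (e : Edge n) : dPre A n (Pre.edge A e) = 0 := by
  rw [dPre_apply]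
  refine Finset.sum_eq_zero fun l _ => ?_
  refine (dPreAt_tmul A l _ _).trans ?_
  rw [MultilinearMap.map_coord_zero _ l (by simp [dFactor, A.d_one]), TensorProduct.zero_tmul]
  rfl

theorem Pre.inc_proj (i : Fin n) (s : ZMod 2) (a : A.carrier) (ha : A.par.proj s a = a) :
    (prePar A n).proj (Pi.single i s, 0) (Pre.inc A i a) = Pre.inc A i a := by
  refine (prePar_tmul A _ _ _).trans ?_
  rw [(edgePar k n).proj_one]
  refine congrArg (· ⊗ₜ[k] (1 : EdgeAlg k n)) (congrArg (PiTensorProduct.tprod k) ?_)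
  funext j
  by_cases hj : j = i
  · subst hj; simp [ha]
  · simp [hj, A.par.proj_one]

theorem edgePar_ι (v : Edge n →₀ k) :
    (edgePar k n).proj 1 (ExteriorAlgebra.ι k v) = ExteriorAlgebra.ι k v := by
  refine (ProjGrading.parityProj_of_mem (fun q : ℕ => ⋀[k]^q (Edge n →₀ k))
    (Nat.castAddMonoidHom (ZMod 2)) 1 (i := 1) ?_).trans (if_pos ?_)
  · change _ ∈ (LinearMap.range (ExteriorAlgebra.ι k)) ^ 1
    rw [pow_one]; exact ⟨v, rfl⟩
  · simp

theorem Pre.edge_proj (v : Edge n →₀ k) :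
    (prePar A n).proj (0, 1) (Pre.mk A (fun _ => 1) (ExteriorAlgebra.ι k v)) =
      Pre.mk A (fun _ => 1) (ExteriorAlgebra.ι k v) := by
  refine (prePar_tmul A _ _ _).trans ?_
  rw [edgePar_ι]
  refine congrArg (· ⊗ₜ[k] (ExteriorAlgebra.ι k v)) (congrArg (PiTensorProduct.tprod k) ?_)
  funext j
  exact A.par.proj_one

theorem involPre_edge (e : Edge n) : involPre A n (Pre.edge A e) = -Pre.edge A e := by
  refine ((prePar A n).signMap_of_proj _ _ _ (Pre.edge_proj A _)).trans ?_
  simp only [Pi.zero_apply, Finset.sum_const_zero, zero_add, sgn_one]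
  exact neg_one_smul k (Pre.edge A e)

theorem involPre_inc (i : Fin n) (a : A.carrier) :
    involPre A n (Pre.inc A i a) = Pre.inc A i (A.invol a) := by
  let f : A.carrier →ₗ[k] Pre A n :=
    { toFun := Pre.inc A i, map_add' := Pre.inc_add A i, map_smul' := Pre.inc_smul A i }
  have h : involPre A n ∘ₗ f = f ∘ₗ A.invol := by
    refine A.par.ext_proj fun s a ha => ?_
    change involPre A n (Pre.inc A i a) = Pre.inc A i (A.invol a)
    rw [A.invol_of_par s a ha, Pre.inc_smul]
    refine ((prePar A n).signMap_of_proj _ _ _ (Pre.inc_proj A i s a ha)).trans ?_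
    simp
    rfl
  exact LinearMap.congr_fun h a

variable (n)

/-- The element `∑ e_ij`, the sum over all `i < j`. -/
def Pre.omega : Pre A n := ∑ e : Edge n, Pre.edge A e

theorem dPre_omega : dPre A n (Pre.omega A n) = 0 := by
  simp [Pre.omega, dPre_edge]

theorem involPre_omega : involPre A n (Pre.omega A n) = -Pre.omega A n := by
  simp [Pre.omega, involPre_edge]

theorem Pre.omega_sq : Pre.omega A n * Pre.omega A n = 0 := by
  have h : Pre.omega A n =
      Pre.mk A (fun _ => 1) (ExteriorAlgebra.ι k (∑ e : Edge n, Finsupp.single e 1)) := by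
    rw [map_sum]
    exact (TensorProduct.tmul_sum _ _ _).symm
  rw [h, pre_mul_def]
  refine ((prePar A n).twistMul_of_proj _ _ _ _ _ (Pre.edge_proj A _) (Pre.edge_proj A _)).trans ?_
  refine (congrArg (fun z : PreModule A n => _ • z)
    ((Algebra.TensorProduct.tmul_mul_tmul _ _ _ _).trans
      (congrArg (_ ⊗ₜ[k] ·) (ExteriorAlgebra.ι_sq_zero _)))).trans ?_
  rw [TensorProduct.tmul_zero, smul_zero]
  rfl

end pre

/-! ### Two-sided ideals and differentials -/

section ideals

variable {k : Type u} [CommRing k] {R : Type v} [Ring R] [Algebra k R]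

/-- If a set `S` spans an ideal containing `σ x` and `D x` for `x ∈ S`, where `σ` is multiplicative
and `D` a `σ`-derivation, then that ideal is stable under `σ` and `D`. -/
theorem span_stable (S : Set R) (σ D : R →ₗ[k] R) (hσ : ∀ x y, σ (x * y) = σ x * σ y)
    (hD : ∀ x y, D (x * y) = D x * y + σ x * D y)
    (h₁ : ∀ x ∈ S, σ x ∈ TwoSidedIdeal.span S) (h₂ : ∀ x ∈ S, D x ∈ TwoSidedIdeal.span S)
    {x : R} (hx : x ∈ TwoSidedIdeal.span S) :
    σ x ∈ TwoSidedIdeal.span S ∧ D x ∈ TwoSidedIdeal.span S := by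
  induction hx using TwoSidedIdeal.span_induction with
  | mem x h => exact ⟨h₁ x h, h₂ x h⟩
  | zero => simp
  | add x y _ _ hx hy =>
    simp only [map_add]
    exact ⟨TwoSidedIdeal.add_mem _ hx.1 hy.1, TwoSidedIdeal.add_mem _ hx.2 hy.2⟩
  | neg x _ hx =>
    simp only [map_neg]
    exact ⟨TwoSidedIdeal.neg_mem _ hx.1, TwoSidedIdeal.neg_mem _ hx.2⟩
  | left_absorb a x hx' hx =>
    rw [hσ, hD]
    exact ⟨TwoSidedIdeal.mul_mem_left _ _ _ hx.1, TwoSidedIdeal.add_mem _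
      (TwoSidedIdeal.mul_mem_left _ _ _ hx') (TwoSidedIdeal.mul_mem_left _ _ _ hx.2)⟩
  | right_absorb b x hx' hx =>
    rw [hσ, hD]
    exact ⟨TwoSidedIdeal.mul_mem_right _ _ _ hx.1, TwoSidedIdeal.add_mem _
      (TwoSidedIdeal.mul_mem_right _ _ _ hx.2) (TwoSidedIdeal.mul_mem_right _ _ _ hx.1)⟩

/-- The linear endomorphism of `R / I` induced by a linear endomorphism of `R` preserving `I`. -/
def quotMap (I : Ideal R) [I.IsTwoSided] (f : R →ₗ[k] R) (hf : ∀ x ∈ I, f x ∈ I) :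
    R ⧸ I →ₗ[k] R ⧸ I :=
  (Submodule.Quotient.restrictScalarsEquiv k I).toLinearMap ∘ₗ
    (Submodule.mapQ (I.restrictScalars k) (I.restrictScalars k) f hf) ∘ₗ
    (Submodule.Quotient.restrictScalarsEquiv k I).symm.toLinearMap

theorem quotMap_mk (I : Ideal R) [I.IsTwoSided] (f : R →ₗ[k] R) (hf : ∀ x ∈ I, f x ∈ I) (x : R) :
    quotMap I f hf (Ideal.Quotient.mk I x) = Ideal.Quotient.mk I (f x) := rfl

end ideals

/-! ### The bicomplex `E(n, A)` -/

section E

variable {k : Type u} [CommRing k] (A : CDGA.{u, v} k) (n : ℕ)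

/-- The ideal of `A^{⊗n} ⊗ Λ(e_ij)` generated by the elements `(e_i(a) - e_j(a)) e_ij`. -/
def relIdeal : Ideal (Pre A n) :=
  (TwoSidedIdeal.span {x | ∃ (e : Edge n) (a : A.carrier),
    x = (Pre.inc A e.1.1 a - Pre.inc A e.1.2 a) * Pre.edge A e}).asIdeal

instance : (relIdeal A n).IsTwoSided := inferInstanceAs (TwoSidedIdeal.asIdeal _).IsTwoSided

theorem relIdeal_stable (x : Pre A n) (hx : x ∈ relIdeal A n) :
    involPre A n x ∈ relIdeal A n ∧ dPre A n x ∈ relIdeal A n := by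
  simp only [relIdeal, TwoSidedIdeal.mem_asIdeal] at hx ⊢
  refine span_stable _ (involPre A n) (dPre A n) (involPre_mul A n) (dPre_mul A n) ?_ ?_ hx
  · rintro _ ⟨e, a, rfl⟩
    rw [involPre_mul, map_sub, involPre_inc, involPre_inc, involPre_edge, mul_neg]
    exact TwoSidedIdeal.neg_mem _ (TwoSidedIdeal.subset_span ⟨e, A.invol a, rfl⟩)
  · rintro _ ⟨e, a, rfl⟩
    rw [dPre_mul, dPre_edge, mul_zero, add_zero, map_sub, dPre_inc, dPre_inc]
    exact TwoSidedIdeal.subset_span ⟨e, A.d a, rfl⟩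

/-- The algebra `E(n, A)`, the quotient of `A^{⊗n} ⊗ Λ(e_ij)` by the relations
`(e_i(a) - e_j(a)) e_ij = 0`. -/
abbrev E : Type (max u v) := Pre A n ⧸ relIdeal A n

/-- The generator `e_ij` of `E(n, A)`. -/
def E.edge {n : ℕ} (e : Edge n) : E A n := Ideal.Quotient.mk _ (Pre.edge A e)

/-- The differential `d'` of `E(n, A)`: left multiplication by `∑ e_ij`. -/
def E.d' : E A n →ₗ[k] E A n := LinearMap.mulLeft k (∑ e : Edge n, E.edge A e)

/-- The differential `d''` of `E(n, A)`, induced by the differential of `A`. -/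
def E.d'' : E A n →ₗ[k] E A n :=
  quotMap (relIdeal A n) (dPre A n) fun x hx => (relIdeal_stable A n x hx).2

/-- The total differential `d = d' + d''` of `E(n, A)`. -/
def E.d : E A n →ₗ[k] E A n := E.d' A n + E.d'' A n

/-- The component of bidegree `(p, q)` of `E(n, A)`, spanned by the classes of the elements
`(a₁ ⊗ ⋯ ⊗ aₙ) ⊗ x` with `aᵢ` homogeneous, `∑ |aᵢ| = p`, and `x` of degree `q`. -/
def E.bidegree (p : ℤ) (q : ℕ) : Submodule k (E A n) :=
  Submodule.span k {z | ∃ (f : Fin n → ℤ) (a : Fin n → A.carrier) (x : EdgeAlg k n),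
    ∑ i, f i = p ∧ (∀ i, a i ∈ A.gr (f i)) ∧ x ∈ ⋀[k]^q (Edge n →₀ k) ∧
    z = Ideal.Quotient.mk (relIdeal A n) (Pre.mk A a x)}

/-- The involution `x ↦ (-1)^{|x|} x` of `E(n, A)`, for the total degree. -/
def E.invol : E A n →ₗ[k] E A n :=
  quotMap (relIdeal A n) (involPre A n) fun x hx => (relIdeal_stable A n x hx).1

theorem E.invol_mul (x y : E A n) :
    E.invol A n (x * y) = E.invol A n x * E.invol A n y := by
  obtain ⟨x, rfl⟩ := Ideal.Quotient.mk_surjective x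
  obtain ⟨y, rfl⟩ := Ideal.Quotient.mk_surjective y
  simp only [E.invol, ← map_mul, quotMap_mk, involPre_mul]

theorem E.d''_mul (x y : E A n) :
    E.d'' A n (x * y) = E.d'' A n x * y + E.invol A n x * E.d'' A n y := by
  obtain ⟨x, rfl⟩ := Ideal.Quotient.mk_surjective x
  obtain ⟨y, rfl⟩ := Ideal.Quotient.mk_surjective y
  simp only [E.d'', E.invol, ← map_mul, quotMap_mk, dPre_mul, map_add]

theorem E.omega_eq :
    ∑ e : Edge n, E.edge A e = Ideal.Quotient.mk (relIdeal A n) (Pre.omega A n) := by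
  rw [Pre.omega, map_sum]; rfl

theorem E.d'_d' (x : E A n) : E.d' A n (E.d' A n x) = 0 := by
  simp only [E.d', LinearMap.mulLeft_apply, E.omega_eq]
  rw [← mul_assoc, ← map_mul, Pre.omega_sq, map_zero, zero_mul]

theorem E.d''_d'' (x : E A n) : E.d'' A n (E.d'' A n x) = 0 := by
  obtain ⟨x, rfl⟩ := Ideal.Quotient.mk_surjective x
  simp only [E.d'', quotMap_mk, dPre_dPre, map_zero]

theorem E.d''_d' (x : E A n) : E.d'' A n (E.d' A n x) = -E.d' A n (E.d'' A n x) := by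
  simp only [E.d', LinearMap.mulLeft_apply, E.omega_eq]
  rw [E.d''_mul]
  simp only [E.d'', E.invol, quotMap_mk, dPre_omega, involPre_omega, map_zero, map_neg, zero_mul,
    zero_add, neg_mul]

theorem E.d_d (x : E A n) : E.d A n (E.d A n x) = 0 := by
  simp only [E.d, LinearMap.add_apply, map_add, E.d'_d', E.d''_d'', E.d''_d']
  simp

/-! ### The ideal `J` and the quotient `Ē(n, A)` -/

/-- The two-sided ideal `J` of `E(n, A)` generated by the products `e_ir e_jr`. -/
def J : Ideal (E A n) :=
  (TwoSidedIdeal.span {x | ∃ (i j r : Fin n) (hi : i < r) (hj : j < r),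
    x = E.edge A ⟨(i, r), hi⟩ * E.edge A ⟨(j, r), hj⟩}).asIdeal

instance : (J A n).IsTwoSided := inferInstanceAs (TwoSidedIdeal.asIdeal _).IsTwoSided

theorem J_d' (x : E A n) (hx : x ∈ J A n) : E.d' A n x ∈ J A n :=
  (J A n).mul_mem_left _ hx

theorem J_d'' (x : E A n) (hx : x ∈ J A n) : E.d'' A n x ∈ J A n := by
  simp only [J, TwoSidedIdeal.mem_asIdeal] at hx ⊢
  refine (span_stable _ (E.invol A n) (E.d'' A n) (E.invol_mul A n) (E.d''_mul A n) ?_ ?_ hx).2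
  · rintro _ ⟨i, j, r, hi, hj, rfl⟩
    rw [E.invol_mul]
    simp only [E.invol, E.edge, quotMap_mk, involPre_edge, map_neg, neg_mul_neg]
    exact TwoSidedIdeal.subset_span ⟨i, j, r, hi, hj, rfl⟩
  · rintro _ ⟨i, j, r, hi, hj, rfl⟩
    rw [E.d''_mul]
    simp only [E.d'', E.edge, quotMap_mk, dPre_edge, map_zero, zero_mul, mul_zero, add_zero]
    exact TwoSidedIdeal.zero_mem _

theorem J_d (x : E A n) (hx : x ∈ J A n) : E.d A n x ∈ J A n :=
  (J A n).add_mem (J_d' A n x hx) (J_d'' A n x hx)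

/-- The `k`-module underlying the ideal `J`. -/
abbrev JModule : Submodule k (E A n) := (J A n).restrictScalars k

/-- The component of bidegree `(p, q)` of `J`, that is `J ∩ E(n, A)^{p,q}`. -/
def JModule.bidegree (p : ℤ) (q : ℕ) : Submodule k (JModule A n) :=
  (E.bidegree A n p q).comap (JModule A n).subtype

/-- The restriction of `d'` to `J`. -/
def JModule.d' : JModule A n →ₗ[k] JModule A n := (E.d' A n).restrict (J_d' A n)

/-- The restriction of `d''` to `J`. -/
def JModule.d'' : JModule A n →ₗ[k] JModule A n := (E.d'' A n).restrict (J_d'' A n)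

/-- The restriction of `d = d' + d''` to `J`. -/
def JModule.d : JModule A n →ₗ[k] JModule A n := JModule.d' A n + JModule.d'' A n

/-- The quotient `Ē(n, A) = E(n, A) / J`. -/
abbrev EBar : Type (max u v) := E A n ⧸ J A n

/-- The total differential induced on `Ē(n, A)`. -/
def EBar.d : EBar A n →ₗ[k] EBar A n := quotMap (J A n) (E.d A n) (J_d A n)

theorem EBar.d_d (x : EBar A n) : EBar.d A n (EBar.d A n x) = 0 := by
  obtain ⟨x, rfl⟩ := Ideal.Quotient.mk_surjective x
  simp only [EBar.d, quotMap_mk, E.d_d, map_zero]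

/-- The canonical projection `E(n, A) → Ē(n, A)`. -/
def EBar.proj : E A n →ₗ[k] EBar A n := (Ideal.Quotient.mkₐ k (J A n)).toLinearMap

theorem EBar.proj_d (x : E A n) : EBar.proj A n (E.d A n x) = EBar.d A n (EBar.proj A n x) := rfl

end E

/-! ### Bicomplexes, acyclicity and quasi-isomorphisms -/

section complexes

variable {k : Type u} [CommRing k]

/-- `M`, with the bigrading `gr` and the endomorphisms `d'` and `d''`, is a bicomplex: it is the
direct sum of its components `gr p q`, the maps `d'` and `d''` have bidegrees `(0, 1)` and `(1, 0)`,
and they are anticommuting differentials. -/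
structure IsBicomplex {M : Type*} [AddCommGroup M] [Module k M] (gr : ℤ → ℕ → Submodule k M)
    (d' d'' : M →ₗ[k] M) : Prop where
  isInternal : DirectSum.IsInternal fun pq : ℤ × ℕ => gr pq.1 pq.2
  d'_mem : ∀ p q x, x ∈ gr p q → d' x ∈ gr p (q + 1)
  d''_mem : ∀ p q x, x ∈ gr p q → d'' x ∈ gr (p + 1) q
  d'_d' : ∀ x, d' (d' x) = 0
  d''_d'' : ∀ x, d'' (d'' x) = 0
  d'_d'' : ∀ x, d' (d'' x) + d'' (d' x) = 0

/-- The cohomology `ker d / im d` of a differential `d`. -/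
abbrev Cohomology {M : Type*} [AddCommGroup M] [Module k M] (d : M →ₗ[k] M)
    (_hd : ∀ x, d (d x) = 0) : Type _ :=
  LinearMap.ker d ⧸ (LinearMap.range d).submoduleOf (LinearMap.ker d)

/-- A differential is acyclic if its cohomology vanishes, i.e. every cocycle is a coboundary. -/
def IsAcyclic {M : Type*} [AddCommGroup M] [Module k M] (d : M →ₗ[k] M) : Prop :=
  ∀ x, d x = 0 → ∃ y, d y = x

/-- The map induced in cohomology by a map commuting with the differentials. -/
def cohomologyMap {M N : Type*} [AddCommGroup M] [Module k M] [AddCommGroup N] [Module k N]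
    (d : M →ₗ[k] M) (hd : ∀ x, d (d x) = 0) (δ : N →ₗ[k] N) (hδ : ∀ x, δ (δ x) = 0)
    (f : M →ₗ[k] N) (hf : ∀ x, f (d x) = δ (f x)) : Cohomology d hd →ₗ[k] Cohomology δ hδ :=
  Submodule.mapQ _ _
    (f.restrict (p := LinearMap.ker d) (q := LinearMap.ker δ) fun x hx => by
      rw [LinearMap.mem_ker] at hx ⊢
      rw [← hf, hx, map_zero])
    (by
      rintro ⟨x, hx⟩ ⟨y, hy⟩
      exact ⟨f y, by rw [← hf, hy]; rfl⟩)

end complexes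

end GraphBicomplex

end

/-! Everything is lifted to the algebra P = A^{⊗n} ⊗ Λ(e_ij) (`Pre`), before the relations are
imposed, because there each edge f has a contraction ι_f: an odd derivation that vanishes on A^{⊗n}
and sends e_g to 1 if g = f and to 0 otherwise. It anticommutes with d'' and sends ω = ∑ e_ij to 1,
so ι_f d + d ι_f = 1 (`contractPre_totalPre`). In general ι_f does not descend to E(n, A): for f =
(i, j), it turns the relation (e_i(a) - e_j(a)) e_ij into a difference e_i(a) - e_j(a) up to sign.
Acyclicity of J comes from finding subquotients of J on which some ι_f does descend.

The preimage of J in P is generated by the relations and the products q = e_ir e_jr with i < j < r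
(`mk_mem_J_iff`). These products are adjoined one at a time, larger r first and then
lexicographically in (j, i). Let I be the ideal generated by the relations and the products that
precede q. Since q is even, central and killed by d'', multiplication by q commutes with d, and the
next subquotient (I + qP)/I is, up to an even shift, the complex P/(I : q). The ideal quotient I : q
is computed exactly (`mem_auxIdeal_of_mul_mem`, `mul_mem_of_mem_auxIdeal`): besides the relations it
is generated by the products ending beyond r, the differences e_i(a) - e_r(a) and e_j(a) - e_r(a),
and the edges e_lr with l ≤ j.

Modulo I : q the classes of e_i(a), e_j(a) and e_r(a) agree, so ι_ij sends the relation of the edge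
(i, j) to zero. No other generator involves e_ij, because j < r. Hence ι_ij descends to P/(I : q)
and is a contracting homotopy there (`mul_contractPre_mem`). The induction along the filtration is
carried out on elements in `exists_totalPre_sub_mem`.

The projection to the quotient by an acyclic subcomplex is a quasi-isomorphism. The bicomplex
structure of J holds because the relations and the generators of J are sums of bihomogeneous ones.
-/

noncomputable section

namespace GraphBicomplex

/-! ### Contraction by an edge -/

section contraction

variable {k : Type u} [CommRing k]

/-- To prove a statement about elements of the exterior algebra of a given parity, it suffices to
consider scalars and products `v ∧ x`. -/
theorem edgePar_induction {n : ℕ} {P : ZMod 2 → EdgeAlg k n → Prop}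
    (zero : ∀ s, P s 0) (add : ∀ s x y, P s x → P s y → P s (x + y))
    (algebraMap : ∀ r, P 0 (algebraMap k (EdgeAlg k n) r))
    (ι_mul : ∀ s v x, (edgePar k n).proj s x = x → P s x → P (s + 1) (ExteriorAlgebra.ι k v * x))
    (s : ZMod 2) (x : EdgeAlg k n) (hx : (edgePar k n).proj s x = x) : P s x := by
  have mem : ∀ (q : ℕ) (x : EdgeAlg k n), x ∈ ⋀[k]^q (Edge n →₀ k) → ∀ s,
      (edgePar k n).proj s x = if (q : ZMod 2) = s then x else 0 := fun q x hx s =>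
    ProjGrading.parityProj_of_mem (fun q : ℕ => ⋀[k]^q (Edge n →₀ k))
      (Nat.castAddMonoidHom (ZMod 2)) s hx
  have key : ∀ (q : ℕ) (x : EdgeAlg k n), x ∈ ⋀[k]^q (Edge n →₀ k) → P (q : ZMod 2) x := by
    intro q x hx
    induction hx using Submodule.pow_induction_on_left' with
    | algebraMap r => simpa using algebraMap r
    | add x y i _ _ hx hy => exact add _ _ _ hx hy
    | mem_mul m hm i x hx ih =>
      obtain ⟨v, rfl⟩ := hm
      push_cast
      exact ι_mul _ v x ((mem i x hx _).trans (if_pos rfl)) ih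
  rw [← hx]
  clear hx
  induction x using DirectSum.Decomposition.inductionOn (fun q : ℕ => ⋀[k]^q (Edge n →₀ k)) with
  | zero => rw [map_zero]; exact zero s
  | @homogeneous i m =>
    rw [mem i m m.2]
    split_ifs with h
    · rw [← h]; exact key i m m.2
    · exact zero s
  | add x y hx hy => rw [map_add]; exact add _ _ _ hx hy

/-- The contraction of the exterior algebra by the linear form dual to an edge. -/
def edgeContract (k : Type u) [CommRing k] {n : ℕ} (f : Edge n) : EdgeAlg k n →ₗ[k] EdgeAlg k n :=
  CliffordAlgebra.contractLeft (Finsupp.lapply f : (Edge n →₀ k) →ₗ[k] k)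

variable {n : ℕ}

theorem edgeContract_ι_mul (f : Edge n) (v : Edge n →₀ k) (x : EdgeAlg k n) :
    edgeContract k f (ExteriorAlgebra.ι k v * x) =
      v f • x - ExteriorAlgebra.ι k v * edgeContract k f x :=
  CliffordAlgebra.contractLeft_ι_mul _ _ _

theorem edgeContract_algebraMap (f : Edge n) (r : k) :
    edgeContract k f (algebraMap k (EdgeAlg k n) r) = 0 :=
  CliffordAlgebra.contractLeft_algebraMap _ _ _

theorem zmod_two_add_one_add_one (s : ZMod 2) : s + 1 + 1 = s := by
  revert s; decide

theorem edgeContract_par (f : Edge n) (s : ZMod 2) (x : EdgeAlg k n)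
    (hx : (edgePar k n).proj s x = x) :
    (edgePar k n).proj (s + 1) (edgeContract k f x) = edgeContract k f x := by
  refine edgePar_induction (P := fun s x => (edgePar k n).proj (s + 1) (edgeContract k f x) =
    edgeContract k f x) (fun s => by simp) (fun s x y hx hy => by simp only [map_add, hx, hy])
    (fun r => by simp [edgeContract_algebraMap]) (fun s v x hx ih => ?_) s x hx
  rw [edgeContract_ι_mul, map_sub, map_smul]
  congr 1
  · rw [zmod_two_add_one_add_one, hx]
  · rw [add_comm (s + 1) 1]
    exact (edgePar k n).mul_proj (edgePar_ι v) ih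

theorem edgeContract_mul (f : Edge n) (s : ZMod 2) (x y : EdgeAlg k n)
    (hx : (edgePar k n).proj s x = x) :
    edgeContract k f (x * y) = edgeContract k f x * y + sgn k s • (x * edgeContract k f y) := by
  refine edgePar_induction (P := fun s x => edgeContract k f (x * y) =
    edgeContract k f x * y + sgn k s • (x * edgeContract k f y)) (fun s => by simp)
    (fun s x x' hx hx' => ?_) (fun r => ?_) (fun s v x hx ih => ?_) s x hx
  · simp only [map_add, add_mul, hx, hx', smul_add]; abel
  · simp [edgeContract_algebraMap, sgn_zero, ← Algebra.smul_def]
  · rw [mul_assoc, edgeContract_ι_mul, ih, edgeContract_ι_mul, sgn_add, sgn_one, mul_add, sub_mul,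
      smul_mul_assoc, mul_smul_comm, mul_neg_one, neg_smul, mul_assoc, mul_assoc]
    abel

/-- Graded commutativity of the exterior algebra, for one factor of degree one. -/
theorem mul_edge_ι (v : Edge n →₀ k) (s : ZMod 2) (x : EdgeAlg k n)
    (hx : (edgePar k n).proj s x = x) :
    x * ExteriorAlgebra.ι k v = sgn k s • (ExteriorAlgebra.ι k v * x) := by
  refine edgePar_induction (P := fun s x => x * ExteriorAlgebra.ι k v =
    sgn k s • (ExteriorAlgebra.ι k v * x)) (fun s => by simp)
    (fun s x x' hx hx' => ?_) (fun r => ?_) (fun s w x hx ih => ?_) s x hx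
  · rw [add_mul, hx, hx', mul_add, smul_add]
  · rw [sgn_zero, one_smul, Algebra.commutes]
  · rw [mul_assoc, ih, mul_smul_comm, ← mul_assoc, ← mul_assoc, sgn_add, sgn_one,
      eq_neg_of_add_eq_zero_left (ExteriorAlgebra.ι_add_mul_swap w v)]
    simp

end contraction

/-! ### The contraction as an odd derivation of `Pre` -/

section contraction

variable {k : Type u} [CommRing k] (A : CDGA.{u, v} k) (n : ℕ)

variable {n} in
/-- To compare linear maps on `A^{⊗n} ⊗ Λ(e_ij)`, it suffices to consider elements all of whose tensor
factors have a given parity. -/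
theorem Pre.ext_proj {M : Type*} [AddCommGroup M] [Module k M] {f f' : Pre A n →ₗ[k] M}
    (h : ∀ (g : (Fin n → ZMod 2) × ZMod 2) (x : Pre A n), (prePar A n).proj g x = x → f x = f' x) :
    f = f' :=
  (prePar A n).ext_proj h

/-- The involution of the tensor power of `A`. -/
def involPow : (⨂[k] _ : Fin n, A.carrier) →ₗ[k] ⨂[k] _ : Fin n, A.carrier :=
  PiTensorProduct.map fun _ => A.invol

theorem involPow_proj (g : Fin n → ZMod 2) (α : ⨂[k] _ : Fin n, A.carrier)
    (hα : (A.par.pi n).proj g α = α) : involPow A n α = sgn k (∑ i, g i) • α := by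
  rw [← hα]
  clear hα
  induction α using PiTensorProduct.induction_on with
  | add x y hx hy => simp only [map_add, hx, hy, smul_add]
  | smul_tprod r a =>
    simp only [map_smul]
    rw [smul_comm]
    congr 1
    change involPow A n (PiTensorProduct.map _ _) = _ • PiTensorProduct.map _ _
    rw [PiTensorProduct.map_tprod, involPow, PiTensorProduct.map_tprod, sgn_sum,
      ← MultilinearMap.map_smul_univ]
    congr 1
    funext i
    exact A.invol_of_par _ _ (A.par.proj_idem _ _)

/-- In the i-th summand of `dPow` only the slot i carries `A.d`, which anticommutes with `A.invol`;
the other slots carry `A.invol` or the identity, which commute with it. Each summand thus acquires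
exactly one sign. -/
theorem dPow_involPow : dPow A n ∘ₗ involPow A n = -(involPow A n ∘ₗ dPow A n) := by
  change dPow A n * involPow A n = -(involPow A n * dPow A n)
  rw [dPow, Finset.sum_mul, Finset.mul_sum, ← Finset.sum_neg_distrib]
  refine Finset.sum_congr rfl fun i _ => ?_
  change _ ∘ₗ _ = -(_ ∘ₗ _)
  rw [involPow, ← PiTensorProduct.map_comp, ← PiTensorProduct.map_comp]
  have h : (fun l => dFactor A i l ∘ₗ A.invol) =
      Function.update (fun l => A.invol ∘ₗ dFactor A i l) i
        ((-1 : k) • (A.invol ∘ₗ dFactor A i i)) := by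
    funext l
    by_cases hl : l = i
    · subst hl
      rw [Function.update_self]
      refine LinearMap.ext fun a => ?_
      refine Eq.trans ?_ (neg_one_smul k (A.invol (dFactor A l l a))).symm
      simpa [dFactor] using LinearMap.congr_fun A.d_invol a
    · rw [Function.update_of_ne hl]
      by_cases hlt : l < i
      · simp [dFactor, hlt]
      · ext a; simp [dFactor, hlt, hl]
  rw [h, PiTensorProduct.map_update_smul, Function.update_eq_self]
  exact LinearMap.ext fun x => neg_one_smul k _

variable {n}

/-- The contraction by an edge on the underlying module of `A^{⊗n} ⊗ Λ(e_ij)`. -/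
def contractModule (f : Edge n) : PreModule A n →ₗ[k] PreModule A n :=
  -- The factor `involPow` is the Koszul sign for moving the odd contraction past A^{⊗n}.
  TensorProduct.map (involPow A n) (edgeContract k f)

/-- The contraction of `A^{⊗n} ⊗ Λ(e_ij)` by an edge, a signed derivation of degree `-1`. -/
def contractPre (f : Edge n) : Pre A n →ₗ[k] Pre A n := contractModule A f

/-- On a component of fixed parities the involution is a scalar. This reduces the Leibniz rule to
the contraction of the exterior factor alone. -/
theorem contractModule_of_proj (f : Edge n) (g : (Fin n → ZMod 2) × ZMod 2) (x : PreModule A n)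
    (hx : (prePar A n).proj g x = x) :
    contractModule A f x =
      sgn k (∑ i, g.1 i) • LinearMap.lTensor (⨂[k] _ : Fin n, A.carrier) (edgeContract k f) x := by
  rw [← hx]
  clear hx
  induction x using TensorProduct.induction_on with
  | zero => simp only [map_zero, smul_zero]
  | add x y hx hy =>
    simp only [map_add, smul_add, hx, hy]
  | tmul α l =>
    have hp : (prePar A n).proj g (α ⊗ₜ l) =
      (A.par.pi n).proj g.1 α ⊗ₜ (edgePar k n).proj g.2 l := TensorProduct.map_tmul _ _ _ _
    rw [hp, contractModule, TensorProduct.map_tmul, LinearMap.lTensor_tmul,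
      involPow_proj A n g.1 _ ((A.par.pi n).proj_idem _ _), TensorProduct.smul_tmul']

theorem contractModule_proj (f : Edge n) (g : (Fin n → ZMod 2) × ZMod 2) (x : PreModule A n)
    (hx : (prePar A n).proj g x = x) :
    (prePar A n).proj (g + (0, 1)) (contractModule A f x) = contractModule A f x := by
  rw [contractModule_of_proj A f g x hx, map_smul]
  congr 1
  rw [← hx]
  clear hx
  induction x using TensorProduct.induction_on with
  | zero => simp only [map_zero]
  | add x y hx hy => simp only [map_add, hx, hy]
  | tmul α l =>
    change TensorProduct.map _ _ (LinearMap.lTensor _ _ (TensorProduct.map _ _ (α ⊗ₜ l))) =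
      LinearMap.lTensor _ _ (TensorProduct.map _ _ (α ⊗ₜ l))
    rw [TensorProduct.map_tmul, LinearMap.lTensor_tmul, TensorProduct.map_tmul,
      Prod.fst_add, Prod.snd_add, add_zero, (A.par.pi n).proj_idem,
      edgeContract_par f _ _ ((edgePar k n).proj_idem _ _)]

/-- The product here is the one of `PreModule`, without Koszul signs, so only the exterior parity
`g.2` enters. The signs of the tensor factors are restored in `contractPre_mul`. -/
theorem lTensor_edgeContract_mul (f : Edge n) (g : (Fin n → ZMod 2) × ZMod 2) (x y : PreModule A n)
    (hx : (prePar A n).proj g x = x) :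
    LinearMap.lTensor (⨂[k] _ : Fin n, A.carrier) (edgeContract k f) (x * y) =
      LinearMap.lTensor (⨂[k] _ : Fin n, A.carrier) (edgeContract k f) x * y +
      sgn k g.2 • (x * LinearMap.lTensor (⨂[k] _ : Fin n, A.carrier) (edgeContract k f) y) := by
  rw [← hx]
  clear hx
  induction x using TensorProduct.induction_on with
  | zero => simp
  | add x x' hx hx' =>
    simp only [map_add, add_mul, hx, hx', smul_add]; abel
  | tmul α l =>
  induction y using TensorProduct.induction_on with
  | zero => simp
  | add y y' hy hy' =>
    simp only [map_add, mul_add, hy, hy', smul_add]; abel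
  | tmul β m =>
    have hp : (prePar A n).proj g (α ⊗ₜ l) =
      (A.par.pi n).proj g.1 α ⊗ₜ (edgePar k n).proj g.2 l := TensorProduct.map_tmul _ _ _ _
    rw [hp]
    simp only [LinearMap.lTensor_tmul, Algebra.TensorProduct.tmul_mul_tmul]
    rw [edgeContract_mul f g.2 _ _ ((edgePar k n).proj_idem _ _), TensorProduct.tmul_add,
      TensorProduct.tmul_smul]

theorem contractPre_mul (f : Edge n) (x y : Pre A n) :
    contractPre A f (x * y) = contractPre A f x * y + involPre A n x * contractPre A f y := by
  -- Modulo two, lowering the exterior degree by one is adding (0, 1). This changes the Koszul sign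
  -- of a product by `∑ j, h.1 j` when done on the left factor and leaves it unchanged when done on
  -- the right one, which dictates the three sign functions.
  refine (prePar A n).leibniz_twistMul (koszul n) (contractModule A f) (0, 1)
    (fun g => (∑ i, g.1 i) + g.2) (fun h => ∑ j, h.1 j) (fun g => (∑ i, g.1 i) + g.2)
    ?_ ?_ (contractModule_proj A f) ?_ x y
  · intro a b
    rw [koszul_add_left]
    simp [koszul]
  · intro a b
    rw [koszul_add_right, add_comm]
    simp [koszul]
  · intro g h x y hx hy
    have hxy := (prePar A n).mul_proj hx hy
    rw [contractModule_of_proj A f _ _ hxy, contractModule_of_proj A f _ _ hx,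
      contractModule_of_proj A f _ _ hy, lTensor_edgeContract_mul A f g x y hx]
    simp only [Prod.fst_add, Pi.add_apply, Finset.sum_add_distrib, sgn_add, smul_add, smul_smul,
      smul_mul_assoc, mul_smul_comm]
    congr 1 <;> congr 1
    · ring
    · rw [mul_comm (sgn k _ * sgn k g.2), mul_comm (sgn k (∑ i, g.1 i)), mul_assoc]

/-- The exterior parts do not interact, and on A^{⊗n} the contraction acts by `involPow`, which
anticommutes with `dPow`. -/
theorem contractPre_dPre (f : Edge n) (x : Pre A n) :
    contractPre A f (dPre A n x) = -dPre A n (contractPre A f x) := by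
  have h : (TensorProduct.map (involPow A n) (edgeContract k f) ∘ₗ
      LinearMap.rTensor (EdgeAlg k n) (dPow A n) : PreModule A n →ₗ[k] PreModule A n) =
      -(LinearMap.rTensor (EdgeAlg k n) (dPow A n) ∘ₗ
        TensorProduct.map (involPow A n) (edgeContract k f)) := by
    refine TensorProduct.ext' fun α l => ?_
    have := LinearMap.congr_fun (dPow_involPow A n) α
    simp only [LinearMap.comp_apply, LinearMap.neg_apply] at this
    simp only [LinearMap.comp_apply, LinearMap.neg_apply, LinearMap.rTensor_tmul,
      TensorProduct.map_tmul, this, TensorProduct.neg_tmul, neg_neg]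
  exact LinearMap.congr_fun h x

theorem contractPre_inc (f : Edge n) (i : Fin n) (a : A.carrier) :
    contractPre A f (Pre.inc A i a) = 0 := by
  refine (TensorProduct.map_tmul (involPow A n) (edgeContract k f) _ _).trans ?_
  rw [← map_one (algebraMap k (EdgeAlg k n)), edgeContract_algebraMap, TensorProduct.tmul_zero]
  rfl

theorem contractPre_edge (f e : Edge n) :
    contractPre A f (Pre.edge A e) = if f = e then 1 else 0 := by
  refine (TensorProduct.map_tmul (involPow A n) (edgeContract k f) _ _).trans ?_
  have h : edgeContract k f (ExteriorAlgebra.ι k (Finsupp.single e 1)) =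
      algebraMap k (EdgeAlg k n) (Finsupp.single e 1 f) := CliffordAlgebra.contractLeft_ι _ _ _
  rw [h, Finsupp.single_apply]
  split_ifs with h1 h2 h2
  · rw [map_one, involPow, PiTensorProduct.map_tprod]
    simp only [invol_one]
    rfl
  · exact absurd h1.symm h2
  · exact absurd h2.symm h1
  · rw [map_zero, TensorProduct.tmul_zero]; rfl

theorem involPre_involPre (x : Pre A n) : involPre A n (involPre A n x) = x := by
  have h : involPre A n ∘ₗ involPre A n = LinearMap.id := by
    refine Pre.ext_proj A fun g x hx => ?_
    have h1 : involPre A n x = sgn k ((∑ i, g.1 i) + g.2) • x := (prePar A n).signMap_of_proj _ g x hx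
    rw [LinearMap.comp_apply, h1, map_smul, h1, smul_smul, sgn_mul_self, one_smul,
      LinearMap.id_apply]
  exact LinearMap.congr_fun h x

/-- An edge commutes with all elements, up to the Koszul sign. -/
theorem mul_edge (e : Edge n) (x : Pre A n) :
    x * Pre.edge A e = Pre.edge A e * involPre A n x := by
  have h : (preMul A n).flip (Pre.edge A e) = preMul A n (Pre.edge A e) ∘ₗ involPre A n := by
    refine Pre.ext_proj A fun g x hx => ?_
    have he := Pre.edge_proj A (n := n) (Finsupp.single e 1)
    have h1 : involPre A n x = sgn k ((∑ i, g.1 i) + g.2) • x := (prePar A n).signMap_of_proj _ g x hx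
    rw [LinearMap.flip_apply, LinearMap.comp_apply, h1, map_smul]
    refine ((prePar A n).twistMul_of_proj _ g (0, 1) x (Pre.edge A e) hx he).trans ?_
    refine Eq.trans ?_ (congrArg (_ • ·)
      ((prePar A n).twistMul_of_proj (koszul n) (0, 1) g (Pre.edge A e) x he hx).symm)
    -- As right factor an edge has no tensor part to be moved, while as left factor it is crossed by
    -- all the tensor factors of `x`. The remaining sign `sgn k g.2` is the commutation inside the
    -- exterior algebra.
    have h2 : koszul n g (0, 1) = 0 := by simp [koszul]
    have h3 : koszul n (0, 1) g = ∑ i, g.1 i := by simp [koszul]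
    rw [h2, h3, sgn_zero, one_smul]
    refine Eq.trans ?_ (smul_smul _ _ _).symm
    have h4 : sgn k ((∑ i, g.1 i) + g.2) * sgn k (∑ i, g.1 i) = sgn k g.2 := by
      rw [sgn_add, mul_right_comm, sgn_mul_self, one_mul]
    rw [h4, ← hx]
    clear hx h1
    change PreModule A n at x
    induction x using TensorProduct.induction_on with
    | zero =>
      rw [map_zero]
      exact (zero_mul _).trans ((congrArg _ (mul_zero _)).trans (smul_zero _)).symm
    | add x y hx hy =>
      rw [map_add]
      refine (add_mul _ _ _).trans ((congrArg₂ (· + ·) hx hy).trans ?_)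
      rw [← smul_add]
      exact congrArg _ (mul_add _ _ _).symm
    | tmul α l =>
      have hp : (prePar A n).proj g (α ⊗ₜ l) =
        (A.par.pi n).proj g.1 α ⊗ₜ (edgePar k n).proj g.2 l := TensorProduct.map_tmul _ _ _ _
      rw [hp]
      refine (Algebra.TensorProduct.tmul_mul_tmul _ _ _ _).trans ?_
      refine Eq.trans ?_ (congrArg (_ • ·) (Algebra.TensorProduct.tmul_mul_tmul _ _ _ _).symm)
      rw [mul_edge_ι _ g.2 _ ((edgePar k n).proj_idem _ _), TensorProduct.tmul_smul]
      have h1 : PiTensorProduct.tprod k (fun _ : Fin n => (1 : A.carrier)) = 1 := rfl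
      rw [h1, one_mul, mul_one]
  exact LinearMap.congr_fun h x

theorem edge_mul (e : Edge n) (x : Pre A n) :
    Pre.edge A e * x = involPre A n x * Pre.edge A e := by
  rw [mul_edge, involPre_involPre]

/-- Graded commutativity gives only 2 e² = 0, so the vanishing is taken from the exterior algebra
itself. -/
theorem edge_mul_self (e : Edge n) : Pre.edge A e * Pre.edge A e = 0 := by
  rw [pre_mul_def]
  refine ((prePar A n).twistMul_of_proj _ _ _ _ _ (Pre.edge_proj A _) (Pre.edge_proj A _)).trans ?_
  refine (congrArg (fun z : PreModule A n => _ • z)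
    ((Algebra.TensorProduct.tmul_mul_tmul _ _ _ _).trans
      (congrArg (_ ⊗ₜ[k] ·) (ExteriorAlgebra.ι_sq_zero _)))).trans ?_
  rw [TensorProduct.tmul_zero, smul_zero]
  rfl

end contraction

/-! ### Acyclicity -/

section derivations

variable {k : Type u} [CommRing k] {R : Type v} [Ring R] [Algebra k R]

/-- A `σ`-derivation `D` maps the two-sided ideal spanned by `S` to the two-sided ideal `I` if
`I` contains the elements `x`, `σ x` and `D x` for `x ∈ S`. -/
theorem derivation_mem_of_mem_span {S : Set R} {I : TwoSidedIdeal R} {σ D : R →ₗ[k] R}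
    (hσ : ∀ x y, σ (x * y) = σ x * σ y) (hD : ∀ x y, D (x * y) = D x * y + σ x * D y)
    (h : ∀ x ∈ S, x ∈ I ∧ σ x ∈ I ∧ D x ∈ I) {x : R} (hx : x ∈ TwoSidedIdeal.span S) :
    x ∈ I ∧ σ x ∈ I ∧ D x ∈ I := by
  -- The three memberships have to be proved together: D (a x) contains the term D a * x, and D (x
  -- b) contains σ x * D b.
  induction hx using TwoSidedIdeal.span_induction with
  | mem x hx => exact h x hx
  | zero => simp
  | add x y _ _ hx hy =>
    simp only [map_add]
    exact ⟨I.add_mem hx.1 hy.1, I.add_mem hx.2.1 hy.2.1, I.add_mem hx.2.2 hy.2.2⟩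
  | neg x _ hx =>
    simp only [map_neg]
    exact ⟨I.neg_mem hx.1, I.neg_mem hx.2.1, I.neg_mem hx.2.2⟩
  | left_absorb a x _ hx =>
    rw [hσ, hD]
    exact ⟨I.mul_mem_left _ _ hx.1, I.mul_mem_left _ _ hx.2.1,
      I.add_mem (I.mul_mem_left _ _ hx.1) (I.mul_mem_left _ _ hx.2.2)⟩
  | right_absorb b x _ hx =>
    rw [hσ, hD]
    exact ⟨I.mul_mem_right _ _ hx.1, I.mul_mem_right _ _ hx.2.1,
      I.add_mem (I.mul_mem_right _ _ hx.2.2) (I.mul_mem_right _ _ hx.2.1)⟩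

end derivations

/-! ### The order in which the products are adjoined -/

section rank

/-- Comparison of numbers written in base `n`: the low digits are below `n`, so the leading part
decides unless it ties. -/
theorem mul_add_lt_mul_add_iff {n a b a' b' : ℕ} (hb : b < n) (hb' : b' < n) :
    a * n + b < a' * n + b' ↔ a < a' ∨ a = a' ∧ b < b' := by
  rcases lt_trichotomy a a' with h | rfl | h
  · have := Nat.mul_le_mul_right n h
    rw [Nat.succ_mul] at this
    constructor
    · intro; exact Or.inl h
    · intro; omega
  · simp
  · have := Nat.mul_le_mul_right n h
    rw [Nat.succ_mul] at this
    constructor <;> intro <;> omega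

/-- The rank of the triple `(i, j, r)`, in the order given by the reverse order of `r` and then by
the lexicographic order of `(j, i)`. -/
def tripleRank {n : ℕ} (i j r : Fin n) : ℕ := ((n - r) * n + j) * n + i

/-- Three digits in base `n`; the leading digit n - r needs no bound. The order in r is reversed so
that, when (i, j, r) is treated, no product ending at j < r has been adjoined yet: such a product
could contain e_ij and obstruct the contraction by it. -/
theorem tripleRank_lt_iff {n : ℕ} (i j r i' j' r' : Fin n) :
    tripleRank i' j' r' < tripleRank i j r ↔
      r < r' ∨ r' = r ∧ (j' < j ∨ j' = j ∧ i' < i) := by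
  rw [tripleRank, tripleRank, mul_add_lt_mul_add_iff i'.2 i.2, mul_add_lt_mul_add_iff j'.2 j.2]
  have h : (n - r' : ℕ) * n + j' = (n - r) * n + j ↔ r' = r ∧ j' = j := by
    have h1 := mul_add_lt_mul_add_iff (a := n - r') (a' := n - r) j'.2 j.2
    have h2 := mul_add_lt_mul_add_iff (a := n - r) (a' := n - r') j.2 j'.2
    constructor
    · intro h
      rw [h] at h1 h2
      simp only [lt_irrefl, false_iff, not_or, not_and] at h1 h2
      constructor <;> ext <;> omega
    · rintro ⟨rfl, rfl⟩; rfl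
  rw [h]
  simp only [Fin.lt_def, Fin.ext_iff]
  omega

theorem tripleRank_inj {n : ℕ} {i j r i' j' r' : Fin n}
    (h : tripleRank i' j' r' = tripleRank i j r) : i' = i ∧ j' = j ∧ r' = r := by
  have h1 := tripleRank_lt_iff i j r i' j' r'
  have h2 := tripleRank_lt_iff i' j' r' i j r
  rw [h] at h1 h2
  simp only [lt_irrefl, false_iff, not_or, not_and, Fin.lt_def, Fin.ext_iff] at h1 h2 ⊢
  omega

end rank

/-! ### Ideals of products and their behaviour under contraction -/

section acyclic

variable {k : Type u} [CommRing k] (A : CDGA.{u, v} k) {n : ℕ}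

/-- The difference `e_i(a) - e_j(a)`. -/
def Pre.diff (i j : Fin n) (a : A.carrier) : Pre A n := Pre.inc A i a - Pre.inc A j a

/-- This expresses what remains of the relation of e_ij after contraction through the differences
against r, which generate the auxiliary ideal. -/
theorem Pre.diff_add_diff (i j r : Fin n) (a : A.carrier) :
    Pre.diff A i j a = Pre.diff A i r a - Pre.diff A j r a := by
  simp only [Pre.diff]; abel

theorem involPre_diff (i j : Fin n) (a : A.carrier) :
    involPre A n (Pre.diff A i j a) = Pre.diff A i j (A.invol a) := by
  simp only [Pre.diff, map_sub, involPre_inc]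

theorem dPre_diff (i j : Fin n) (a : A.carrier) :
    dPre A n (Pre.diff A i j a) = Pre.diff A i j (A.d a) := by
  simp only [Pre.diff, map_sub, dPre_inc]

theorem contractPre_diff (f : Edge n) (i j : Fin n) (a : A.carrier) :
    contractPre A f (Pre.diff A i j a) = 0 := by
  simp only [Pre.diff, map_sub, contractPre_inc, sub_zero]

theorem edge_mul_edge (e f : Edge n) :
    Pre.edge A e * Pre.edge A f = -(Pre.edge A f * Pre.edge A e) := by
  rw [mul_edge, involPre_edge, mul_neg]

theorem contractPre_edge_mul (f e : Edge n) (x : Pre A n) :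
    contractPre A f (Pre.edge A e * x) =
      (if f = e then x else 0) - Pre.edge A e * contractPre A f x := by
  rw [contractPre_mul, contractPre_edge, involPre_edge, neg_mul, ← sub_eq_add_neg, ite_mul, one_mul,
    zero_mul]

/-- A product of two edges is central. -/
theorem edge_mul_edge_comm (e f : Edge n) (x : Pre A n) :
    Pre.edge A e * Pre.edge A f * x = x * (Pre.edge A e * Pre.edge A f) := by
  rw [mul_assoc, edge_mul A f, ← mul_assoc, edge_mul A e, involPre_involPre, mul_assoc]

variable (n) in
/-- The relations `(e_i(a) - e_j(a)) e_ij`. -/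
def relGens : Set (Pre A n) :=
  {x | ∃ (e : Edge n) (a : A.carrier), x = Pre.diff A e.1.1 e.1.2 a * Pre.edge A e}

variable (n) in
/-- The products `e_ir e_jr` with `i < j < r` and `P i j r`. -/
def pairGens (P : Fin n → Fin n → Fin n → Prop) : Set (Pre A n) :=
  {x | ∃ (i j r : Fin n) (hij : i < j) (hjr : j < r), P i j r ∧
    x = Pre.edge A ⟨(i, r), hij.trans hjr⟩ * Pre.edge A ⟨(j, r), hjr⟩}

variable (n) in
/-- The ideal generated by the relations and by the products `e_ir e_jr` with `P i j r`. -/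
def pairIdeal (P : Fin n → Fin n → Fin n → Prop) : TwoSidedIdeal (Pre A n) :=
  TwoSidedIdeal.span (relGens A n ∪ pairGens A n P)

theorem pairIdeal_mono {P Q : Fin n → Fin n → Fin n → Prop} (h : ∀ i j r, i < j → j < r → P i j r → Q i j r) :
    pairIdeal A n P ≤ pairIdeal A n Q := by
  refine TwoSidedIdeal.span_mono (Set.union_subset_union_right _ ?_)
  rintro _ ⟨i, j, r, hij, hjr, hP, rfl⟩
  exact ⟨i, j, r, hij, hjr, h i j r hij hjr hP, rfl⟩

/-- The ideal generated by the relations, by the differences `e_l(a) - e_r(a)` with `l ∈ C`, by the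
edges `e_lr` with `l ∈ B`, and by the products `e_is e_js` with `r < s`. -/
def auxIdeal (r : Fin n) (C B : Set (Fin n)) : TwoSidedIdeal (Pre A n) :=
  TwoSidedIdeal.span (relGens A n ∪ pairGens A n (fun _ _ s => r < s) ∪
    {x | ∃ l ∈ C, ∃ a, x = Pre.diff A l r a} ∪
    {x | ∃ l ∈ B, ∃ h : l < r, x = Pre.edge A ⟨(l, r), h⟩})

section auxIdeal

variable {A} {r : Fin n} {C B : Set (Fin n)}

theorem relGens_mem_auxIdeal {x : Pre A n} (hx : x ∈ relGens A n) : x ∈ auxIdeal A r C B :=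
  TwoSidedIdeal.subset_span (Or.inl (Or.inl (Or.inl hx)))

theorem pairGens_mem_auxIdeal {x : Pre A n} (hx : x ∈ pairGens A n (fun _ _ s => r < s)) :
    x ∈ auxIdeal A r C B :=
  TwoSidedIdeal.subset_span (Or.inl (Or.inl (Or.inr hx)))

theorem diff_mem_auxIdeal {l : Fin n} (hl : l ∈ C) (a : A.carrier) :
    Pre.diff A l r a ∈ auxIdeal A r C B :=
  TwoSidedIdeal.subset_span (Or.inl (Or.inr ⟨l, hl, a, rfl⟩))

theorem edge_mem_auxIdeal {l : Fin n} (hl : l ∈ B) (h : l < r) :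
    Pre.edge A ⟨(l, r), h⟩ ∈ auxIdeal A r C B :=
  TwoSidedIdeal.subset_span (Or.inr ⟨l, hl, h, rfl⟩)

end auxIdeal

theorem involPre_relGens {x : Pre A n} (hx : x ∈ relGens A n) :
    ∃ y ∈ relGens A n, involPre A n x = -y := by
  obtain ⟨e, a, rfl⟩ := hx
  exact ⟨_, ⟨e, A.invol a, rfl⟩, by rw [involPre_mul, involPre_diff, involPre_edge, mul_neg]⟩

theorem dPre_relGens {x : Pre A n} (hx : x ∈ relGens A n) : dPre A n x ∈ relGens A n := by
  obtain ⟨e, a, rfl⟩ := hx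
  exact ⟨e, A.d a, by rw [dPre_mul, dPre_edge, mul_zero, add_zero, dPre_diff]⟩

/-- Only the relations of the edge `f` itself survive the contraction, and they leave bare
differences; so the membership of these differences is the only condition. -/
theorem contractPre_relGens {f : Edge n} {I : TwoSidedIdeal (Pre A n)}
    (hf : ∀ a, Pre.diff A f.1.1 f.1.2 a ∈ I) {x : Pre A n} (hx : x ∈ relGens A n) :
    contractPre A f x ∈ I := by
  obtain ⟨e, a, rfl⟩ := hx
  rw [contractPre_mul, contractPre_diff, zero_mul, zero_add, involPre_diff, contractPre_edge]
  split_ifs with h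
  · subst h
    rw [mul_one]; exact hf _
  · rw [mul_zero]; exact I.zero_mem

theorem involPre_pairGens {P : Fin n → Fin n → Fin n → Prop} {x : Pre A n}
    (hx : x ∈ pairGens A n P) : involPre A n x = x := by
  obtain ⟨i, j, r, hij, hjr, _, rfl⟩ := hx
  rw [involPre_mul, involPre_edge, involPre_edge, neg_mul_neg]

theorem dPre_pairGens {P : Fin n → Fin n → Fin n → Prop} {x : Pre A n}
    (hx : x ∈ pairGens A n P) : dPre A n x = 0 := by
  obtain ⟨i, j, r, hij, hjr, _, rfl⟩ := hx
  rw [dPre_mul, dPre_edge, dPre_edge, mul_zero, zero_mul, add_zero]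

/-- Both edges of the product end at r, so an edge ending strictly before r is neither of them. -/
theorem contractPre_pairGens {P : Fin n → Fin n → Fin n → Prop} {f : Edge n}
    (hf : ∀ i j r, P i j r → f.1.2 < r) {x : Pre A n} (hx : x ∈ pairGens A n P) :
    contractPre A f x = 0 := by
  obtain ⟨i, j, r, hij, hjr, hP, rfl⟩ := hx
  have h := hf i j r hP
  rw [contractPre_edge_mul, contractPre_edge, if_neg, if_neg, mul_zero, sub_zero]
  · rintro rfl; exact lt_irrefl _ h
  · rintro rfl; exact lt_irrefl _ h

/-- The contraction by `f` maps `auxIdeal A r C B` to `auxIdeal A r C' B'` if the former contains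
no products with `f` among its generators. -/
theorem contractPre_auxIdeal {f : Edge n} {r : Fin n} {C C' B B' : Set (Fin n)} (hC : C ⊆ C')
    (hB : B ⊆ B') (hf : f.1.2 ≤ r) (hfB : ∀ l ∈ B, f.1 ≠ (l, r))
    (hdiff : ∀ a, Pre.diff A f.1.1 f.1.2 a ∈ auxIdeal A r C' B') {x : Pre A n}
    (hx : x ∈ auxIdeal A r C B) :
    x ∈ auxIdeal A r C' B' ∧ contractPre A f x ∈ auxIdeal A r C' B' := by
  refine (fun h => ⟨h.1, h.2.2⟩) (derivation_mem_of_mem_span (involPre_mul A n)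
    (contractPre_mul A f) ?_ hx)
  rintro x (((hx | hx) | ⟨l, hl, a, rfl⟩) | ⟨l, hl, hlr, rfl⟩)
  · obtain ⟨y, hy, e⟩ := involPre_relGens A hx
    rw [e]
    exact ⟨relGens_mem_auxIdeal hx, TwoSidedIdeal.neg_mem _ (relGens_mem_auxIdeal hy),
      contractPre_relGens A hdiff hx⟩
  · rw [involPre_pairGens A hx, contractPre_pairGens A (fun i j s hs => hf.trans_lt hs) hx]
    exact ⟨pairGens_mem_auxIdeal hx, pairGens_mem_auxIdeal hx, TwoSidedIdeal.zero_mem _⟩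
  · rw [involPre_diff, contractPre_diff]
    exact ⟨diff_mem_auxIdeal (hC hl) a, diff_mem_auxIdeal (hC hl) _, TwoSidedIdeal.zero_mem _⟩
  · rw [involPre_edge, contractPre_edge, if_neg]
    · exact ⟨edge_mem_auxIdeal (hB hl) hlr,
        TwoSidedIdeal.neg_mem _ (edge_mem_auxIdeal (hB hl) hlr), TwoSidedIdeal.zero_mem _⟩
    · rintro rfl; exact hfB l hl rfl

/-- If `e_f y` lies in an ideal `I`, then `y` lies in any ideal containing `I`, its contraction by
`f`, and `e_f`. -/
theorem mem_of_edge_mul_mem {f : Edge n} {I I' : TwoSidedIdeal (Pre A n)}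
    (h : ∀ x ∈ I, contractPre A f x ∈ I') (hf : Pre.edge A f ∈ I') {y : Pre A n}
    (hy : Pre.edge A f * y ∈ I) : y ∈ I' := by
  -- The contraction turns e_f y into y - e_f ι_f(y), and the second term is a multiple of e_f.
  have h1 := h _ hy
  rw [contractPre_edge_mul, if_pos rfl] at h1
  have h2 := I'.add_mem h1 (I'.mul_mem_right _ (contractPre A f y) hf)
  rwa [sub_add_cancel] at h2

/-- The predicate of preceding the triple `(i, j, r)`. -/
def Precedes (i j r i' j' r' : Fin n) : Prop := tripleRank i' j' r' < tripleRank i j r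

/-! ### The ideal quotient by a product `e_ir e_jr` -/

section step

variable {i j r : Fin n}

/-- A preceding product either ends beyond r, and is killed, or has the form e_i'r e_j'r with i' <
j, and lies in the target because of e_i'r. If contraction removes e_i'r, that is i' = i, then e_j'r
is left with j' < j, since j' = j would require i' < i. -/
theorem contractPre_pairIdeal (hij : i < j) (hjr : j < r) {x : Pre A n} (hx : x ∈ pairIdeal A n (Precedes i j r)) :
    contractPre A ⟨(i, r), hij.trans hjr⟩ x ∈ auxIdeal A r {i} (Set.Iio j) := by
  have hd : ∀ a, Pre.diff A i r a ∈ auxIdeal A r {i} (Set.Iio j) :=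
    fun a => diff_mem_auxIdeal (Set.mem_singleton i) a
  refine (derivation_mem_of_mem_span (I := auxIdeal A r {i} (Set.Iio j)) (involPre_mul A n)
    (contractPre_mul A ⟨(i, r), hij.trans hjr⟩) ?_ hx).2.2
  rintro x (hx | hx)
  · obtain ⟨y, hy, e⟩ := involPre_relGens A hx
    rw [e]
    exact ⟨relGens_mem_auxIdeal hx, TwoSidedIdeal.neg_mem _ (relGens_mem_auxIdeal hy),
      contractPre_relGens A (f := ⟨(i, r), hij.trans hjr⟩) hd hx⟩
  · rw [involPre_pairGens A hx, ← and_assoc, and_self]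
    obtain ⟨i', j', r', hij', hjr', hP, rfl⟩ := hx
    rw [Precedes, tripleRank_lt_iff] at hP
    rcases hP with h | ⟨rfl, h⟩
    · have hx : Pre.edge A ⟨(i', r'), hij'.trans hjr'⟩ * Pre.edge A ⟨(j', r'), hjr'⟩ ∈
          pairGens A n (fun _ _ s => r < s) := ⟨i', j', r', hij', hjr', h, rfl⟩
      refine ⟨pairGens_mem_auxIdeal hx, ?_⟩
      rw [contractPre_pairGens A (fun _ _ _ hs => hs) hx]
      exact TwoSidedIdeal.zero_mem _
    · have hi' : i' < j := by
        rcases h with h | ⟨rfl, h⟩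
        · exact hij'.trans h
        · exact hij'
      have he := edge_mem_auxIdeal (A := A) (C := {i}) (B := Set.Iio j) hi' (hij'.trans hjr')
      refine ⟨TwoSidedIdeal.mul_mem_right _ _ _ he, ?_⟩
      rw [contractPre_edge_mul]
      refine TwoSidedIdeal.sub_mem _ ?_ (TwoSidedIdeal.mul_mem_right _ _ _ he)
      split_ifs with h0
      · refine edge_mem_auxIdeal ?_ hjr'
        rcases h with h | ⟨rfl, h⟩
        · exact h
        · simp only [Subtype.mk.injEq, Prod.mk.injEq] at h0
          exact absurd h0.1 h.ne'
      · exact TwoSidedIdeal.zero_mem _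

/-- The two edges are stripped off by successive contractions, first e_ir and then e_jr. Each
contraction puts the differences belonging to its edge into the ideal; e_ir already lies there as i
< j, and e_jr is added at the second stage. -/
theorem mem_auxIdeal_of_mul_mem (hij : i < j) (hjr : j < r) {y : Pre A n}
    (hy : Pre.edge A ⟨(i, r), hij.trans hjr⟩ * Pre.edge A ⟨(j, r), hjr⟩ * y ∈
      pairIdeal A n (Precedes i j r)) : y ∈ auxIdeal A r {i, j} (Set.Iic j) := by
  rw [mul_assoc] at hy
  have h1 : Pre.edge A ⟨(j, r), hjr⟩ * y ∈ auxIdeal A r {i} (Set.Iio j) :=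
    mem_of_edge_mul_mem A (fun x hx => contractPre_pairIdeal A hij hjr hx)
      (edge_mem_auxIdeal (Set.mem_Iio.2 hij) _) hy
  refine mem_of_edge_mul_mem A (I := auxIdeal A r {i} (Set.Iio j)) (fun x hx => ?_)
    (edge_mem_auxIdeal Set.self_mem_Iic hjr) h1
  have hC : ({i} : Set (Fin n)) ⊆ {i, j} := by simp
  have hB : ∀ l ∈ Set.Iio j, (j, r) ≠ (l, r) := by
    rintro l hl h
    simp only [Prod.mk.injEq, and_true] at h
    exact (Set.mem_Iio.1 hl).ne' h
  have hj : j ∈ ({i, j} : Set (Fin n)) := by simp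
  have hd : ∀ a, Pre.diff A j r a ∈ auxIdeal A r {i, j} (Set.Iic j) :=
    fun a => diff_mem_auxIdeal hj a
  exact (contractPre_auxIdeal A (f := ⟨(j, r), hjr⟩) hC Set.Iio_subset_Iic_self le_rfl hB hd hx).2

/-- With the preceding lemma this identifies the ideal quotient by q = e_ir e_jr with `auxIdeal A r
{i, j} (Set.Iic j)`. As q is central, only the generators matter: a difference times q is a multiple
of a relation, and an edge e_lr with l ≤ j times q is zero or a multiple of a preceding product. -/
theorem mul_mem_of_mem_auxIdeal (hij : i < j) (hjr : j < r) {y : Pre A n} (hy : y ∈ auxIdeal A r {i, j} (Set.Iic j)) :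
    Pre.edge A ⟨(i, r), hij.trans hjr⟩ * Pre.edge A ⟨(j, r), hjr⟩ * y ∈
      pairIdeal A n (Precedes i j r) := by
  set I := pairIdeal A n (Precedes i j r) with hI
  set q := Pre.edge A ⟨(i, r), hij.trans hjr⟩ * Pre.edge A ⟨(j, r), hjr⟩ with hq
  have hrel : ∀ x ∈ relGens A n, x ∈ I := fun x hx => TwoSidedIdeal.subset_span (Or.inl hx)
  have hpair : ∀ x ∈ pairGens A n (Precedes i j r), x ∈ I :=
    fun x hx => TwoSidedIdeal.subset_span (Or.inr hx)
  induction hy using TwoSidedIdeal.span_induction with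
  | zero => rw [mul_zero]; exact I.zero_mem
  | add x y _ _ hx hy => rw [mul_add]; exact I.add_mem hx hy
  | neg x _ hx => rw [mul_neg]; exact I.neg_mem hx
  | left_absorb a x _ hx =>
    rw [← mul_assoc, edge_mul_edge_comm, mul_assoc]
    exact I.mul_mem_left _ _ hx
  | right_absorb b x _ hx =>
    rw [← mul_assoc]
    exact I.mul_mem_right _ _ hx
  | mem x hx =>
    rcases hx with ((hx | hx) | ⟨l, hl, a, rfl⟩) | ⟨l, hl, hlr, rfl⟩
    · exact I.mul_mem_left _ _ (hrel x hx)
    · obtain ⟨i', j', r', hij', hjr', hP, rfl⟩ := hx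
      refine I.mul_mem_left _ _ (hpair _ ⟨i', j', r', hij', hjr', ?_, rfl⟩)
      rw [Precedes, tripleRank_lt_iff]
      exact Or.inl hP
    · rw [edge_mul_edge_comm]
      rcases hl with rfl | rfl
      · rw [← mul_assoc]
        exact I.mul_mem_right _ _ (hrel _ ⟨⟨(l, r), hij.trans hjr⟩, a, rfl⟩)
      · rw [edge_mul_edge, mul_neg, ← mul_assoc]
        exact I.neg_mem (I.mul_mem_right _ _ (hrel _ ⟨⟨(l, r), hjr⟩, a, rfl⟩))
    · rcases lt_or_eq_of_le (show l ≤ j from hl) with hlj | rfl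
      · rw [hq, mul_assoc, edge_mul_edge, mul_neg, ← mul_assoc]
        refine I.neg_mem (I.mul_mem_right _ _ ?_)
        -- For l < j, the edges e_lr and e_ir form a product whose larger index, i or l, is less
        -- than j, so it precedes (i, j, r); for l = i it is a square.
        rcases lt_trichotomy l i with hli | rfl | hli
        · rw [edge_mul_edge]
          refine I.neg_mem (hpair _ ⟨l, i, r, hli, hij.trans hjr, ?_, rfl⟩)
          rw [Precedes, tripleRank_lt_iff]
          exact Or.inr ⟨rfl, Or.inl hij⟩
        · rw [edge_mul_self]; exact I.zero_mem
        · refine hpair _ ⟨i, l, r, hli, hlr, ?_, rfl⟩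
          rw [Precedes, tripleRank_lt_iff]
          exact Or.inr ⟨rfl, Or.inl hlj⟩
      · rw [hq, mul_assoc, edge_mul_self, mul_zero]
        exact I.zero_mem

/-- The ideal quotient of the preceding products by `e_ir e_jr` is stable under the contraction by
`e_ij`. -/
theorem mul_contractPre_mem (hij : i < j) (hjr : j < r) {y : Pre A n}
    (hy : Pre.edge A ⟨(i, r), hij.trans hjr⟩ * Pre.edge A ⟨(j, r), hjr⟩ * y ∈
      pairIdeal A n (Precedes i j r)) :
    Pre.edge A ⟨(i, r), hij.trans hjr⟩ * Pre.edge A ⟨(j, r), hjr⟩ * contractPre A ⟨(i, j), hij⟩ y ∈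
      pairIdeal A n (Precedes i j r) := by
  -- In the description by generators, e_ij is none of the edges e_lr because j ≠ r, and its
  -- relation contracts to (e_i - e_r) - (e_j - e_r), up to the involution on A.
  refine mul_mem_of_mem_auxIdeal A hij hjr (contractPre_auxIdeal A subset_rfl subset_rfl hjr.le ?_ ?_
    (mem_auxIdeal_of_mul_mem A hij hjr hy)).2
  · rintro l _ h
    simp only [Prod.mk.injEq] at h
    exact hjr.ne h.2
  · intro a
    rw [Pre.diff_add_diff A i j r]
    exact TwoSidedIdeal.sub_mem _ (diff_mem_auxIdeal (by simp) a) (diff_mem_auxIdeal (by simp) a)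

end step

end acyclic

/-! ### The contracting homotopy and the induction along the filtration -/

section total

variable {k : Type u} [CommRing k] (A : CDGA.{u, v} k) {n : ℕ}

variable (n) in
/-- The total differential of `A^{⊗n} ⊗ Λ(e_ij)`. -/
def totalPre : Pre A n →ₗ[k] Pre A n := LinearMap.mulLeft k (Pre.omega A n) + dPre A n

theorem totalPre_apply (x : Pre A n) : totalPre A n x = Pre.omega A n * x + dPre A n x := rfl

theorem E.d_mk (x : Pre A n) :
    E.d A n (Ideal.Quotient.mk _ x) = Ideal.Quotient.mk (relIdeal A n) (totalPre A n x) := by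
  rw [totalPre_apply, map_add, map_mul, ← E.omega_eq]
  rfl

theorem contractPre_omega (f : Edge n) : contractPre A f (Pre.omega A n) = 1 := by
  simp [Pre.omega, contractPre_edge]

/-- The homotopy identity ι d + d ι = 1. The identity term comes from ι(ω) = 1; the other terms
cancel because ι is an odd derivation and anticommutes with d''. -/
theorem contractPre_totalPre (f : Edge n) (x : Pre A n) :
    contractPre A f (totalPre A n x) = x - totalPre A n (contractPre A f x) := by
  rw [totalPre_apply, totalPre_apply, map_add, contractPre_mul, contractPre_omega, one_mul,
    involPre_omega, contractPre_dPre, neg_mul]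
  abel

/-- A product of two edges is even, central and killed by d'', so multiplication by it is a map of
complexes without sign. -/
theorem totalPre_edge_mul_edge (e f : Edge n) (x : Pre A n) :
    totalPre A n (Pre.edge A e * Pre.edge A f * x) =
      Pre.edge A e * Pre.edge A f * totalPre A n x := by
  rw [totalPre_apply, totalPre_apply, mul_add, dPre_mul, dPre_mul, dPre_edge, dPre_edge, mul_zero,
    zero_mul, add_zero, zero_mul, zero_add, involPre_mul, involPre_edge, involPre_edge, neg_mul_neg,
    ← mul_assoc, ← edge_mul_edge_comm, ← mul_assoc]

theorem totalPre_mem_pairIdeal {P : Fin n → Fin n → Fin n → Prop} {x : Pre A n}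
    (hx : x ∈ pairIdeal A n P) : totalPre A n x ∈ pairIdeal A n P := by
  refine TwoSidedIdeal.add_mem _ (TwoSidedIdeal.mul_mem_left _ _ _ hx)
    (derivation_mem_of_mem_span (involPre_mul A n) (dPre_mul A n) ?_ hx).2.2
  rintro x (hx | hx)
  · obtain ⟨y, hy, e⟩ := involPre_relGens A hx
    rw [e]
    exact ⟨TwoSidedIdeal.subset_span (Or.inl hx),
      TwoSidedIdeal.neg_mem _ (TwoSidedIdeal.subset_span (Or.inl hy)),
      TwoSidedIdeal.subset_span (Or.inl (dPre_relGens A hx))⟩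
  · rw [involPre_pairGens A hx, dPre_pairGens A hx]
    exact ⟨TwoSidedIdeal.subset_span (Or.inr hx), TwoSidedIdeal.subset_span (Or.inr hx),
      TwoSidedIdeal.zero_mem _⟩

theorem mem_relIdeal {x : Pre A n} : x ∈ relIdeal A n ↔ x ∈ TwoSidedIdeal.span (relGens A n) :=
  TwoSidedIdeal.mem_asIdeal

theorem mem_pairIdeal_of_mem_relIdeal {P : Fin n → Fin n → Fin n → Prop} {x : Pre A n}
    (hx : x ∈ relIdeal A n) : x ∈ pairIdeal A n P :=
  TwoSidedIdeal.span_mono Set.subset_union_left ((mem_relIdeal A).1 hx)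

/-- The ideal generated by the relations and by the products `e_ir e_jr` of rank less than `m + 1`
is obtained by adding the multiples of the product of rank `m`. -/
theorem exists_eq_add_of_mem_pairIdeal {i j r : Fin n} (hij : i < j) (hjr : j < r) {x : Pre A n}
    (hx : x ∈ pairIdeal A n fun i' j' r' => tripleRank i' j' r' < tripleRank i j r + 1) :
    ∃ u ∈ pairIdeal A n (Precedes i j r), ∃ y,
      x = u + Pre.edge A ⟨(i, r), hij.trans hjr⟩ * Pre.edge A ⟨(j, r), hjr⟩ * y := by
  set I := pairIdeal A n (Precedes i j r) with hI
  set q := Pre.edge A ⟨(i, r), hij.trans hjr⟩ * Pre.edge A ⟨(j, r), hjr⟩ with hq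
  induction hx using TwoSidedIdeal.span_induction with
  | zero => exact ⟨0, I.zero_mem, 0, by rw [mul_zero, add_zero]⟩
  | add x x' _ _ hx hx' =>
    obtain ⟨u, hu, y, rfl⟩ := hx
    obtain ⟨u', hu', y', rfl⟩ := hx'
    exact ⟨u + u', I.add_mem hu hu', y + y', by rw [mul_add]; abel⟩
  | neg x _ hx =>
    obtain ⟨u, hu, y, rfl⟩ := hx
    exact ⟨-u, I.neg_mem hu, -y, by rw [mul_neg]; abel⟩
  | left_absorb a x _ hx =>
    obtain ⟨u, hu, y, rfl⟩ := hx
    refine ⟨a * u, I.mul_mem_left _ _ hu, a * y, ?_⟩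
    rw [mul_add, ← mul_assoc, ← edge_mul_edge_comm, mul_assoc _ a]
  | right_absorb b x _ hx =>
    obtain ⟨u, hu, y, rfl⟩ := hx
    exact ⟨u * b, I.mul_mem_right _ _ hu, y * b, by rw [add_mul, mul_assoc _ y]⟩
  | mem x hx =>
    rcases hx with hx | ⟨i', j', r', hij', hjr', hP, rfl⟩
    · exact ⟨x, TwoSidedIdeal.subset_span (Or.inl hx), 0, by rw [mul_zero, add_zero]⟩
    · rcases Nat.lt_succ_iff_lt_or_eq.1 hP with hP | hP
      · exact ⟨_, TwoSidedIdeal.subset_span (Or.inr ⟨i', j', r', hij', hjr', hP, rfl⟩), 0,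
          by rw [mul_zero, add_zero]⟩
      · obtain ⟨rfl, rfl, rfl⟩ := tripleRank_inj hP
        exact ⟨0, I.zero_mem, 1, by rw [mul_one, zero_add]⟩

/-- Every cocycle modulo the relations in the ideal generated by the products `e_ir e_jr` of rank
less than `m` is a coboundary modulo the relations. -/
theorem exists_totalPre_sub_mem (m : ℕ) (x : Pre A n)
    (hx : x ∈ pairIdeal A n fun i j r => tripleRank i j r < m)
    (hd : totalPre A n x ∈ relIdeal A n) :
    ∃ y ∈ pairIdeal A n fun i j r => tripleRank i j r < m, x - totalPre A n y ∈ relIdeal A n := by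
  induction m generalizing x with
  | zero =>
    -- No rank is negative, so at the bottom of the filtration the ideal is that of the relations.
    refine ⟨0, TwoSidedIdeal.zero_mem _, ?_⟩
    rw [map_zero, sub_zero, mem_relIdeal]
    have h : relGens A n ∪ pairGens A n (fun i j r => tripleRank i j r < 0) = relGens A n := by
      refine Set.union_eq_left.2 ?_
      rintro _ ⟨i, j, r, _, _, h, _⟩
      exact absurd h (Nat.not_lt_zero _)
    rwa [pairIdeal, h] at hx
  | succ m ih =>
    by_cases h : ∃ i j r : Fin n, i < j ∧ j < r ∧ tripleRank i j r = m
    · obtain ⟨i, j, r, hij, hjr, rfl⟩ := h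
      obtain ⟨u, hu, y, rfl⟩ := exists_eq_add_of_mem_pairIdeal A hij hjr hx
      have hle : pairIdeal A n (Precedes i j r) ≤
          pairIdeal A n fun i' j' r' => tripleRank i' j' r' < tripleRank i j r + 1 :=
        pairIdeal_mono A fun _ _ _ _ _ h => Nat.lt_succ_of_lt h
      -- Since x = u + q y is a cocycle modulo the relations and the ideal of preceding products is
      -- stable under d, the class of y is a cocycle modulo the ideal quotient by q.
      have hqd : Pre.edge A ⟨(i, r), hij.trans hjr⟩ * Pre.edge A ⟨(j, r), hjr⟩ * totalPre A n y ∈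
          pairIdeal A n (Precedes i j r) := by
        have h1 := TwoSidedIdeal.sub_mem _ (mem_pairIdeal_of_mem_relIdeal A hd)
          (totalPre_mem_pairIdeal A hu)
        rwa [map_add, add_sub_cancel_left, totalPre_edge_mul_edge] at h1
      have hc := mul_contractPre_mem A hij hjr hqd
      -- By the homotopy identity, q y is d(q ι_ij y) modulo the preceding products. Subtracting
      -- this coboundary moves x one step down the filtration.
      rw [contractPre_totalPre, mul_sub, ← totalPre_edge_mul_edge] at hc
      set q := Pre.edge A ⟨(i, r), hij.trans hjr⟩ * Pre.edge A ⟨(j, r), hjr⟩ with hq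
      set z := q * contractPre A ⟨(i, j), hij⟩ y with hz
      have hz' : z ∈ pairIdeal A n fun i' j' r' => tripleRank i' j' r' < tripleRank i j r + 1 :=
        TwoSidedIdeal.mul_mem_right _ _ _
          (TwoSidedIdeal.subset_span (Or.inr ⟨i, j, r, hij, hjr, Nat.lt_succ_self _, rfl⟩))
      have hzz : totalPre A n (totalPre A n z) ∈ relIdeal A n := by
        rw [← Ideal.Quotient.eq_zero_iff_mem, ← E.d_mk, ← E.d_mk, E.d_d]
      obtain ⟨w, hw, hw'⟩ := ih (u + (q * y - totalPre A n z))
        (TwoSidedIdeal.add_mem _ hu hc) (by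
          have h2 := (relIdeal A n).sub_mem hd hzz
          rwa [← map_sub, add_sub_assoc] at h2)
      refine ⟨z + w, TwoSidedIdeal.add_mem _ hz' (hle hw), ?_⟩
      rw [map_add]
      convert hw' using 1
      abel
    -- If no triple i < j < r has rank m, nothing is adjoined and the two ideals coincide.
    · have hle : ∀ x, (x ∈ pairIdeal A n fun i' j' r' => tripleRank i' j' r' < m + 1) ↔
          x ∈ pairIdeal A n fun i' j' r' => tripleRank i' j' r' < m := fun x => by
        constructor
        · refine fun hx => pairIdeal_mono A (fun i j r hij hjr h' => ?_) hx
          exact lt_of_le_of_ne (Nat.lt_succ_iff.1 h') fun h0 => h ⟨i, j, r, hij, hjr, h0⟩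
        · exact fun hx => pairIdeal_mono A (fun i j r hij hjr h' => Nat.lt_succ_of_lt h') hx
      simp only [hle] at hx ⊢
      exact ih x hx hd

variable (n) in
/-- The preimage of `J` in `A^{⊗n} ⊗ Λ(e_ij)` is generated by the relations and the products
`e_ir e_jr` with `i < j < r`. -/
theorem mk_mem_J_iff (x : Pre A n) :
    Ideal.Quotient.mk (relIdeal A n) x ∈ J A n ↔ x ∈ pairIdeal A n fun _ _ _ => True := by
  constructor
  · intro hx
    have key : ∀ z ∈ J A n, ∃ y ∈ pairIdeal A n fun _ _ _ => True,
        Ideal.Quotient.mk (relIdeal A n) y = z := by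
      intro z hz
      rw [J, TwoSidedIdeal.mem_asIdeal] at hz
      induction hz using TwoSidedIdeal.span_induction with
      | zero => exact ⟨0, TwoSidedIdeal.zero_mem _, map_zero _⟩
      | add _ _ _ _ hx hy =>
        obtain ⟨x, hx, rfl⟩ := hx
        obtain ⟨y, hy, rfl⟩ := hy
        exact ⟨x + y, TwoSidedIdeal.add_mem _ hx hy, map_add _ _ _⟩
      | neg _ _ hx =>
        obtain ⟨x, hx, rfl⟩ := hx
        exact ⟨-x, TwoSidedIdeal.neg_mem _ hx, map_neg _ _⟩
      | left_absorb a _ _ hx =>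
        obtain ⟨x, hx, rfl⟩ := hx
        obtain ⟨a, rfl⟩ := Ideal.Quotient.mk_surjective a
        exact ⟨a * x, TwoSidedIdeal.mul_mem_left _ _ _ hx, map_mul _ _ _⟩
      | right_absorb b _ _ hx =>
        obtain ⟨x, hx, rfl⟩ := hx
        obtain ⟨b, rfl⟩ := Ideal.Quotient.mk_surjective b
        exact ⟨x * b, TwoSidedIdeal.mul_mem_right _ _ _ hx, map_mul _ _ _⟩
      | mem z hz =>
        obtain ⟨i, j, r, hi, hj, rfl⟩ := hz
        refine ⟨Pre.edge A ⟨(i, r), hi⟩ * Pre.edge A ⟨(j, r), hj⟩, ?_, map_mul _ _ _⟩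
        -- The generators of J allow i ≥ j; squares vanish, and exchanging the two edges only
        -- changes the sign.
        rcases lt_trichotomy i j with h | rfl | h
        · exact TwoSidedIdeal.subset_span (Or.inr ⟨i, j, r, h, hj, trivial, rfl⟩)
        · rw [edge_mul_self]; exact TwoSidedIdeal.zero_mem _
        · rw [edge_mul_edge]
          exact TwoSidedIdeal.neg_mem _
            (TwoSidedIdeal.subset_span (Or.inr ⟨j, i, r, h, hi, trivial, rfl⟩))
    obtain ⟨y, hy, hyx⟩ := key _ hx
    have h1 := mem_pairIdeal_of_mem_relIdeal A (P := fun _ _ _ => True)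
      (Ideal.Quotient.eq.1 hyx.symm)
    have h2 := TwoSidedIdeal.add_mem _ h1 hy
    rwa [sub_add_cancel] at h2
  · intro hx
    induction hx using TwoSidedIdeal.span_induction with
    | zero => rw [map_zero]; exact (J A n).zero_mem
    | add x y _ _ hx hy => rw [map_add]; exact (J A n).add_mem hx hy
    | neg x _ hx => rw [map_neg]; exact (J A n).neg_mem hx
    | left_absorb a x _ hx => rw [map_mul]; exact (J A n).mul_mem_left _ hx
    | right_absorb b x _ hx => rw [map_mul]; exact (J A n).mul_mem_right _ hx
    | mem x hx =>
      rcases hx with hx | ⟨i, j, r, hij, hjr, _, rfl⟩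
      · rw [Ideal.Quotient.eq_zero_iff_mem.2 ((mem_relIdeal A).2 (TwoSidedIdeal.subset_span hx))]
        exact (J A n).zero_mem
      · rw [map_mul]
        exact TwoSidedIdeal.mem_asIdeal.2
          (TwoSidedIdeal.subset_span ⟨i, j, r, hij.trans hjr, hjr, rfl⟩)

theorem exists_forall_tripleRank_lt (n : ℕ) : ∃ m, ∀ i j r : Fin n, tripleRank i j r < m := by
  obtain ⟨m, hm⟩ := (Set.finite_range
    fun t : Fin n × Fin n × Fin n => tripleRank t.1 t.2.1 t.2.2).bddAbove
  exact ⟨m + 1, fun i j r => Nat.lt_succ_of_le (hm ⟨(i, j, r), rfl⟩)⟩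

variable (n) in
/-- The ideal `J` is acyclic for the total differential. -/
theorem JModule.isAcyclic : IsAcyclic (JModule.d A n) := by
  rintro ⟨x, hx⟩ hd
  obtain ⟨x, rfl⟩ := Ideal.Quotient.mk_surjective x
  obtain ⟨m, hm⟩ := exists_forall_tripleRank_lt n
  have hP : (fun _ _ _ : Fin n => True) = fun i j r => tripleRank i j r < m := by
    funext i j r
    exact (eq_true (hm i j r)).symm
  have hx' := (mk_mem_J_iff A n x).1 hx
  have hd' : totalPre A n x ∈ relIdeal A n := by
    rw [← Ideal.Quotient.eq_zero_iff_mem, ← E.d_mk]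
    exact congrArg Subtype.val hd
  rw [hP] at hx'
  obtain ⟨y, hy, hxy⟩ := exists_totalPre_sub_mem A m x hx' hd'
  rw [← hP] at hy
  refine ⟨⟨Ideal.Quotient.mk _ y, (mk_mem_J_iff A n y).2 hy⟩, Subtype.ext ?_⟩
  change E.d A n (Ideal.Quotient.mk _ y) = Ideal.Quotient.mk _ x
  rw [E.d_mk]
  exact (Ideal.Quotient.eq.2 hxy).symm

/-! ### The projection as a quasi-isomorphism -/

variable (n) in
/-- The canonical projection `E(n, A) → Ē(n, A)` is a quasi-isomorphism. -/
theorem EBar.bijective_cohomologyMap_proj : Function.Bijective (cohomologyMap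
    (E.d A n) (E.d_d A n) (EBar.d A n) (EBar.d_d A n) (EBar.proj A n) (EBar.proj_d A n)) := by
  have hJ : ∀ x ∈ J A n, E.d A n x = 0 → ∃ y ∈ J A n, E.d A n y = x := by
    intro x hx hd
    obtain ⟨y, hy⟩ := JModule.isAcyclic A n ⟨x, hx⟩ (Subtype.ext hd)
    exact ⟨y.1, y.2, congrArg Subtype.val hy⟩
  have hker : ∀ x, EBar.proj A n x = 0 ↔ x ∈ J A n := fun x => Ideal.Quotient.eq_zero_iff_mem
  have hsurj : ∀ z, ∃ x, EBar.proj A n x = z := Ideal.Quotient.mk_surjective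
  constructor
  · rw [← LinearMap.ker_eq_bot, LinearMap.ker_eq_bot']
    intro c hc
    obtain ⟨⟨x, hx⟩, rfl⟩ := Submodule.Quotient.mk_surjective _ c
    rw [LinearMap.mem_ker] at hx
    obtain ⟨w, hw⟩ := (Submodule.Quotient.mk_eq_zero _).1 hc
    obtain ⟨y, rfl⟩ := hsurj w
    have hw' : EBar.d A n (EBar.proj A n y) = EBar.proj A n x := hw
    -- If the image of the cocycle x is the coboundary of the image of y, then x - d y is a cocycle
    -- in J, hence a coboundary.
    obtain ⟨z, _, hz⟩ := hJ (x - E.d A n y)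
      (by rw [← hker, map_sub, EBar.proj_d, hw', sub_self])
      (by rw [map_sub, hx, E.d_d, sub_zero])
    refine (Submodule.Quotient.mk_eq_zero _).2 ⟨z + y, ?_⟩
    rw [map_add, hz, sub_add_cancel]
    rfl
  · intro c
    obtain ⟨⟨z, hz⟩, rfl⟩ := Submodule.Quotient.mk_surjective _ c
    obtain ⟨x, rfl⟩ := hsurj z
    rw [LinearMap.mem_ker, ← EBar.proj_d, hker] at hz
    -- The differential of a lift x of a cocycle is a cocycle in J, so it is d w with w in J; then x
    -- - w is a cocycle with the same image.
    obtain ⟨w, hwJ, hw⟩ := hJ _ hz (E.d_d A n x)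
    refine ⟨Submodule.Quotient.mk ⟨x - w, ?_⟩, ?_⟩
    · rw [LinearMap.mem_ker, map_sub, hw, sub_self]
    · refine congrArg Submodule.Quotient.mk (Subtype.ext ?_)
      change EBar.proj A n (x - w) = EBar.proj A n x
      rw [map_sub, (hker w).2 hwJ, sub_zero]

end total

/-! ### The bigrading -/

section gradings

variable {k : Type u} [CommRing k]

/-- The two-sided ideal `I` spanned by `S` in a graded ring is homogeneous if the elements of `S` are
sums of homogeneous elements of `I`. -/
theorem mem_iSup_inf_of_mem_span {R Γ : Type*} [Ring R] [Algebra k R] [Add Γ]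
    {G : Γ → Submodule k R} (hmul : ∀ g h x y, x ∈ G g → y ∈ G h → x * y ∈ G (g + h))
    (htop : ⨆ g, G g = ⊤) {S : Set R} {I : Submodule k R}
    (hI : ∀ x, x ∈ I ↔ x ∈ TwoSidedIdeal.span S) (hS : ∀ x ∈ S, x ∈ ⨆ g, I ⊓ G g) {x : R}
    (hx : x ∈ TwoSidedIdeal.span S) : x ∈ ⨆ g, I ⊓ G g := by
  have hmem : ∀ g x, x ∈ I → x ∈ G g → x ∈ ⨆ g, I ⊓ G g := fun g x hx hg =>
    Submodule.mem_iSup_of_mem g ⟨hx, hg⟩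
  have htop' : ∀ x, x ∈ ⨆ g, G g := fun x => htop ▸ Submodule.mem_top
  induction hx using TwoSidedIdeal.span_induction with
  | mem x hx => exact hS x hx
  | zero => exact Submodule.zero_mem _
  | add x y _ _ hx hy => exact Submodule.add_mem _ hx hy
  | neg x _ hx => exact Submodule.neg_mem _ hx
  | left_absorb a x hm hx =>
    clear hm
    induction hx using Submodule.iSup_induction' with
    | zero => rw [mul_zero]; exact Submodule.zero_mem _
    | add x y _ _ hx hy => rw [mul_add]; exact Submodule.add_mem _ hx hy
    | mem g x hx =>
      induction htop' a using Submodule.iSup_induction' with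
      | zero => rw [zero_mul]; exact Submodule.zero_mem _
      | add a b _ _ ha hb => rw [add_mul]; exact Submodule.add_mem _ ha hb
      | mem h a ha =>
        exact hmem _ _ ((hI _).2 (TwoSidedIdeal.mul_mem_left _ _ _ ((hI _).1 hx.1)))
          (hmul _ _ _ _ ha hx.2)
  | right_absorb a x hm hx =>
    clear hm
    induction hx using Submodule.iSup_induction' with
    | zero => rw [zero_mul]; exact Submodule.zero_mem _
    | add x y _ _ hx hy => rw [add_mul]; exact Submodule.add_mem _ hx hy
    | mem g x hx =>
      induction htop' a using Submodule.iSup_induction' with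
      | zero => rw [mul_zero]; exact Submodule.zero_mem _
      | add a b _ _ ha hb => rw [mul_add]; exact Submodule.add_mem _ ha hb
      | mem h a ha =>
        exact hmem _ _ ((hI _).2 (TwoSidedIdeal.mul_mem_right _ _ _ ((hI _).1 hx.1)))
          (hmul _ _ _ _ hx.2 ha)

/-- A module spanned by submodules which are separated by linear maps is their direct sum. -/
theorem isInternal_of_projections {M M' Γ : Type*} [AddCommGroup M] [Module k M] [AddCommGroup M']
    [Module k M'] [DecidableEq Γ] {N : Γ → Submodule k M} (htop : ⨆ g, N g = ⊤) {ι : M →ₗ[k] M'}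
    (hι : Function.Injective ι) (π : Γ → M →ₗ[k] M')
    (hπ : ∀ g h x, x ∈ N h → π g x = if g = h then ι x else 0) : DirectSum.IsInternal N := by
  refine DirectSum.isInternal_submodule_of_iSupIndep_of_iSup_eq_top ?_ htop
  rw [iSupIndep_def]
  refine fun g => Submodule.disjoint_def.2 fun x hx hx' => hι ?_
  -- The map `π g` kills the sum of the other components and agrees with the injection `ι` on `N g`.
  have h1 : ⨆ h, ⨆ (_ : h ≠ g), N h ≤ LinearMap.ker (π g) :=
    iSup₂_le fun h hh y hy => by rw [LinearMap.mem_ker, hπ g h y hy, if_neg hh.symm]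
  rw [map_zero, ← LinearMap.mem_ker.1 (h1 hx'), hπ g g x hx, if_pos rfl]

end gradings

/-! ### Bihomogeneous components of `Pre`, of E(n, A) and of J -/

section bidegree

variable {k : Type u} [CommRing k] (A : CDGA.{u, v} k) (n : ℕ)

/-- The projection of `A^{⊗n}` onto the component of total degree `p`. -/
def powProj (p : ℤ) : (⨂[k] _ : Fin n, A.carrier) →ₗ[k] ⨂[k] _ : Fin n, A.carrier :=
  -- A tensor power of a direct sum is the direct sum over all degree functions f; the summands with
  -- ∑ f i = p are kept.
  DirectSum.toModule k (Fin n → ℤ) _ (fun f => if ∑ i, f i = p then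
      PiTensorProduct.map fun i => (A.gr (f i)).subtype else 0) ∘ₗ
    (PiTensorProduct.ofDirectSumEquiv (R := k) (M := fun (_ : Fin n) p => A.gr p)).toLinearMap ∘ₗ
      PiTensorProduct.map fun _ => (DirectSum.decomposeLinearEquiv A.gr).toLinearMap

variable {n} in
theorem powProj_tprod (p : ℤ) (f : Fin n → ℤ) (a : Fin n → A.carrier) (ha : ∀ i, a i ∈ A.gr (f i)) :
    powProj A n p (PiTensorProduct.tprod k a) =
      if ∑ i, f i = p then PiTensorProduct.tprod k a else 0 := by
  lift a to ∀ i, A.gr (f i) using ha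
  have h : (fun i => (DirectSum.decomposeLinearEquiv A.gr).toLinearMap (a i : A.carrier)) =
      fun i => DirectSum.lof k ℤ (fun p => A.gr p) (f i) (a i) := by
    funext i
    rw [LinearEquiv.coe_coe, DirectSum.decomposeLinearEquiv_apply, DirectSum.decompose_coe]
    rfl
  rw [powProj, LinearMap.comp_apply, LinearMap.comp_apply, PiTensorProduct.map_tprod, h,
    LinearEquiv.coe_coe, PiTensorProduct.ofDirectSumEquiv_tprod_lof, DirectSum.toModule_lof]
  split_ifs
  · rw [PiTensorProduct.map_tprod]; rfl
  · rfl

/-- The component of bidegree `(p, q)` of `A^{⊗n} ⊗ Λ(e_ij)`. -/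
def Pre.bidegree (g : ℤ × ℕ) : Submodule k (Pre A n) :=
  Submodule.span k {z | ∃ (f : Fin n → ℤ) (a : Fin n → A.carrier) (x : EdgeAlg k n),
    ∑ i, f i = g.1 ∧ (∀ i, a i ∈ A.gr (f i)) ∧ x ∈ ⋀[k]^g.2 (Edge n →₀ k) ∧ z = Pre.mk A a x}

/-- The projection of `A^{⊗n} ⊗ Λ(e_ij)` onto the component of bidegree `(p, q)`. -/
def Pre.bidegreeProj (g : ℤ × ℕ) : Pre A n →ₗ[k] Pre A n :=
  (TensorProduct.map (powProj A n g.1)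
    (GradedAlgebra.proj (fun q : ℕ => ⋀[k]^q (Edge n →₀ k)) g.2) : PreModule A n →ₗ[k] PreModule A n)

theorem Pre.bidegreeProj_of_mem (g h : ℤ × ℕ) (x : Pre A n) (hx : x ∈ Pre.bidegree A n h) :
    Pre.bidegreeProj A n g x = if g = h then x else 0 := by
  induction hx using Submodule.span_induction with
  | zero => rw [map_zero, ite_self]
  | add x y _ _ hx hy => rw [map_add, hx, hy]; split_ifs <;> simp
  | smul r x _ hx => rw [map_smul, hx]; split_ifs <;> simp
  | mem x hx =>
    obtain ⟨f, a, x, hf, ha, hx, rfl⟩ := hx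
    refine (TensorProduct.map_tmul _ _ _ _).trans ?_
    rw [powProj_tprod A g.1 f a ha, GradedAlgebra.proj_apply]
    by_cases h2 : h.2 = g.2
    · rw [h2] at hx
      rw [DirectSum.decompose_of_mem_same (fun q : ℕ => ⋀[k]^q (Edge n →₀ k)) hx]
      by_cases h1 : h.1 = g.1
      · rw [if_pos (hf.trans h1), if_pos (Prod.ext h1.symm h2.symm)]
        rfl
      · rw [if_neg (fun e => h1 (hf.symm.trans e)), if_neg (fun e => h1 (congrArg Prod.fst e).symm),
          TensorProduct.zero_tmul]
        rfl
    · rw [DirectSum.decompose_of_mem_ne (fun q : ℕ => ⋀[k]^q (Edge n →₀ k)) hx h2,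
        if_neg (fun e => h2 (congrArg Prod.snd e).symm), TensorProduct.tmul_zero]
      rfl

theorem Pre.mul_mem_bidegree (g h : ℤ × ℕ) (x y : Pre A n) (hx : x ∈ Pre.bidegree A n g)
    (hy : y ∈ Pre.bidegree A n h) : x * y ∈ Pre.bidegree A n (g + h) := by
  induction hx using Submodule.span_induction with
  | zero => rw [zero_mul]; exact Submodule.zero_mem _
  | add x x' _ _ hx hx' => rw [add_mul]; exact Submodule.add_mem _ hx hx'
  | smul r x _ hx => rw [smul_mul_assoc]; exact Submodule.smul_mem _ _ hx
  | mem x hx =>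
    induction hy using Submodule.span_induction with
    | zero => rw [mul_zero]; exact Submodule.zero_mem _
    | add y y' _ _ hy hy' => rw [mul_add]; exact Submodule.add_mem _ hy hy'
    | smul r y _ hy => rw [mul_smul_comm]; exact Submodule.smul_mem _ _ hy
    | mem y hy =>
      obtain ⟨f, a, x, hf, ha, hx, rfl⟩ := hx
      obtain ⟨f', b, y, hf', hb, hy, rfl⟩ := hy
      rw [Pre.mk_mul_mk A f f' g.2 h.2 a b x y ha hb hx hy, negOnePow_smul k]
      refine Submodule.smul_mem _ _ (Submodule.subset_span ⟨f + f', _, _, ?_,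
        fun i => SetLike.mul_mem_graded (ha i) (hb i), ?_, rfl⟩)
      · rw [Prod.fst_add, ← hf, ← hf', ← Finset.sum_add_distrib]; rfl
      · exact SetLike.mul_mem_graded (A := fun q : ℕ => ⋀[k]^q (Edge n →₀ k)) hx hy

theorem Pre.iSup_bidegree : ⨆ g, Pre.bidegree A n g = ⊤ := by
  classical
  refine eq_top_iff.2 fun x _ => ?_
  change PreModule A n at x
  induction x using TensorProduct.induction_on with
  | zero => exact Submodule.zero_mem _
  | add x y hx hy => exact Submodule.add_mem _ (hx trivial) (hy trivial)
  | tmul α l =>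
    induction α using PiTensorProduct.induction_on with
    | add α β hα hβ =>
      rw [TensorProduct.add_tmul]
      exact Submodule.add_mem _ (hα trivial) (hβ trivial)
    | smul_tprod r a =>
      rw [← TensorProduct.smul_tmul']
      refine Submodule.smul_mem _ r ?_
      have ha : a = fun i => ∑ p ∈ (DirectSum.decompose A.gr (a i)).support,
          (DirectSum.decompose A.gr (a i) p : A.carrier) :=
        funext fun i => (DirectSum.sum_support_decompose A.gr (a i)).symm
      have hl := DirectSum.sum_support_decompose (fun q : ℕ => ⋀[k]^q (Edge n →₀ k)) l
      rw [ha, MultilinearMap.map_sum_finset, ← hl, TensorProduct.sum_tmul]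
      refine Submodule.sum_mem _ fun f _ => ?_
      rw [TensorProduct.tmul_sum]
      refine Submodule.sum_mem _ fun q _ => ?_
      exact Submodule.mem_iSup_of_mem (∑ i, f i, q) (Submodule.subset_span
        ⟨f, _, _, rfl, fun i => SetLike.coe_mem _, SetLike.coe_mem _, rfl⟩)

variable {n}

theorem Pre.inc_mem_bidegree (i : Fin n) {p : ℤ} {a : A.carrier} (ha : a ∈ A.gr p) :
    Pre.inc A i a ∈ Pre.bidegree A n (p, 0) := by
  refine Submodule.subset_span ⟨Pi.single i p, _, _, by simp, fun j => ?_,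
    SetLike.GradedOne.one_mem (A := fun q : ℕ => ⋀[k]^q (Edge n →₀ k)), rfl⟩
  by_cases hj : j = i
  · subst hj; simpa using ha
  · simpa [hj] using SetLike.GradedOne.one_mem (A := A.gr)

theorem Pre.edge_mem_bidegree (e : Edge n) : Pre.edge A e ∈ Pre.bidegree A n (0, 1) := by
  refine Submodule.subset_span ⟨0, _, _, by simp,
    fun j => SetLike.GradedOne.one_mem (A := A.gr), ?_, rfl⟩
  change _ ∈ (LinearMap.range (ExteriorAlgebra.ι k)) ^ 1
  rw [pow_one]
  exact ⟨_, rfl⟩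

theorem Pre.dPre_mem_bidegree {p : ℤ} {q : ℕ} {x : Pre A n} (hx : x ∈ Pre.bidegree A n (p, q)) :
    dPre A n x ∈ Pre.bidegree A n (p + 1, q) := by
  induction hx using Submodule.span_induction with
  | zero => rw [map_zero]; exact Submodule.zero_mem _
  | add x y _ _ hx hy => rw [map_add]; exact Submodule.add_mem _ hx hy
  | smul r x _ hx => rw [map_smul]; exact Submodule.smul_mem _ _ hx
  | mem x hx =>
    obtain ⟨f, a, x, hf, ha, hx, rfl⟩ := hx
    rw [dPre_apply]
    refine Submodule.sum_mem _ fun i _ => ?_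
    -- The i-th summand raises the degree in slot i alone; the involution in the slots before i
    -- preserves degrees.
    refine Submodule.subset_span ⟨f + Pi.single i 1, _, x, ?_, fun j => ?_, hx,
      dPreAt_tmul A i a x⟩
    · simp only [Pi.add_apply, Finset.sum_add_distrib, hf]
      simp
    · by_cases hj : j = i
      · subst hj
        simpa [dFactor] using A.d_mem _ _ (ha j)
      · have h0 : (f + Pi.single i 1 : Fin n → ℤ) j = f j := by simp [hj]
        rw [h0]
        by_cases hlt : j < i
        · simp only [dFactor, hlt, if_true]
          rw [A.invol_of_par (f j : ZMod 2) _ ((A.par_of_mem _ (ha j)).trans (if_pos rfl))]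
          exact Submodule.smul_mem _ _ (ha j)
        · simpa [dFactor, hlt, hj] using ha j

/-- The ideal of relations is homogeneous. -/
theorem mem_iSup_of_mem_relIdeal {x : Pre A n} (hx : x ∈ relIdeal A n) :
    x ∈ ⨆ g, (relIdeal A n).restrictScalars k ⊓ Pre.bidegree A n g := by
  classical
  refine mem_iSup_inf_of_mem_span (Pre.mul_mem_bidegree A n) (Pre.iSup_bidegree A n)
    (fun x => mem_relIdeal A) ?_ ((mem_relIdeal A).1 hx)
  rintro _ ⟨e, a, rfl⟩
  -- A relation is additive in a, and for a of degree p it has bidegree (p, 1).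
  induction a using DirectSum.Decomposition.inductionOn A.gr with
  | zero =>
    simp only [Pre.diff, Pre.inc_zero, sub_zero, zero_mul]
    exact Submodule.zero_mem _
  | add a b ha hb =>
    have h : Pre.diff A e.1.1 e.1.2 (a + b) = Pre.diff A e.1.1 e.1.2 a + Pre.diff A e.1.1 e.1.2 b := by
      simp only [Pre.diff, Pre.inc_add]; abel
    rw [h, add_mul]
    exact Submodule.add_mem _ ha hb
  | @homogeneous p a =>
    refine Submodule.mem_iSup_of_mem ((p, 0) + (0, 1))
      ⟨(mem_relIdeal A).2 (TwoSidedIdeal.subset_span ⟨e, a, rfl⟩), ?_⟩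
    exact Pre.mul_mem_bidegree A n _ _ _ _ (Submodule.sub_mem _ (Pre.inc_mem_bidegree A _ a.2)
      (Pre.inc_mem_bidegree A _ a.2)) (Pre.edge_mem_bidegree A e)

/-- A homogeneous ideal is stable under the projections onto the components; this is what makes them
descend to E(n, A). -/
theorem Pre.bidegreeProj_mem_relIdeal (g : ℤ × ℕ) (x : Pre A n) (hx : x ∈ relIdeal A n) :
    Pre.bidegreeProj A n g x ∈ relIdeal A n := by
  have hx' := mem_iSup_of_mem_relIdeal A hx
  clear hx
  induction hx' using Submodule.iSup_induction' with
  | zero => rw [map_zero]; exact (relIdeal A n).zero_mem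
  | add x y _ _ hx hy =>
    rw [map_add]; exact (relIdeal A n).add_mem hx hy
  | mem h x hx =>
    rw [Pre.bidegreeProj_of_mem A n g h x hx.2]
    split_ifs
    · exact hx.1
    · exact (relIdeal A n).zero_mem

variable (n)

/-- The projection of `E(n, A)` onto the component of bidegree `(p, q)`. -/
def E.bidegreeProj (g : ℤ × ℕ) : E A n →ₗ[k] E A n :=
  quotMap (relIdeal A n) (Pre.bidegreeProj A n g) (Pre.bidegreeProj_mem_relIdeal A g)

theorem E.bidegree_eq_map (g : ℤ × ℕ) :
    E.bidegree A n g.1 g.2 =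
      (Pre.bidegree A n g).map (Ideal.Quotient.mkₐ k (relIdeal A n)).toLinearMap := by
  rw [E.bidegree, Pre.bidegree, Submodule.map_span]
  congr 1
  ext z
  constructor
  · rintro ⟨f, a, x, hf, ha, hx, rfl⟩
    exact ⟨_, ⟨f, a, x, hf, ha, hx, rfl⟩, rfl⟩
  · rintro ⟨_, ⟨f, a, x, hf, ha, hx, rfl⟩, rfl⟩
    exact ⟨f, a, x, hf, ha, hx, rfl⟩

theorem E.mem_bidegree {g : ℤ × ℕ} {z : E A n} :
    z ∈ E.bidegree A n g.1 g.2 ↔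
      ∃ x ∈ Pre.bidegree A n g, Ideal.Quotient.mk (relIdeal A n) x = z := by
  rw [E.bidegree_eq_map]; rfl

theorem E.bidegreeProj_of_mem (g h : ℤ × ℕ) (z : E A n) (hz : z ∈ E.bidegree A n h.1 h.2) :
    E.bidegreeProj A n g z = if g = h then z else 0 := by
  obtain ⟨x, hx, rfl⟩ := (E.mem_bidegree A n).1 hz
  rw [E.bidegreeProj, quotMap_mk, Pre.bidegreeProj_of_mem A n g h x hx]
  split_ifs <;> simp

theorem E.mul_mem_bidegree (g h : ℤ × ℕ) (x y : E A n) (hx : x ∈ E.bidegree A n g.1 g.2)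
    (hy : y ∈ E.bidegree A n h.1 h.2) : x * y ∈ E.bidegree A n (g + h).1 (g + h).2 := by
  obtain ⟨x, hx', rfl⟩ := (E.mem_bidegree A n).1 hx
  obtain ⟨y, hy', rfl⟩ := (E.mem_bidegree A n).1 hy
  exact (E.mem_bidegree A n).2 ⟨x * y, Pre.mul_mem_bidegree A n _ _ _ _ hx' hy', map_mul _ _ _⟩

theorem E.iSup_bidegree : ⨆ g : ℤ × ℕ, E.bidegree A n g.1 g.2 = ⊤ := by
  simp only [E.bidegree_eq_map]
  rw [← Submodule.map_iSup, Pre.iSup_bidegree, Submodule.map_top, LinearMap.range_eq_top]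
  exact Ideal.Quotient.mk_surjective

theorem E.edge_mem_bidegree (e : Edge n) : E.edge A e ∈ E.bidegree A n 0 1 :=
  (E.mem_bidegree A n (g := (0, 1))).2 ⟨_, Pre.edge_mem_bidegree A e, rfl⟩

/-- The ideal `J` is homogeneous. -/
theorem mem_iSup_of_mem_J {x : E A n} (hx : x ∈ J A n) :
    x ∈ ⨆ g : ℤ × ℕ, JModule A n ⊓ E.bidegree A n g.1 g.2 := by
  refine mem_iSup_inf_of_mem_span (E.mul_mem_bidegree A n) (E.iSup_bidegree A n)
    (fun x => TwoSidedIdeal.mem_asIdeal) ?_ (TwoSidedIdeal.mem_asIdeal.1 hx)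
  rintro _ ⟨i, j, r, hi, hj, rfl⟩
  exact Submodule.mem_iSup_of_mem ((0, 1) + (0, 1))
    ⟨TwoSidedIdeal.mem_asIdeal.2 (TwoSidedIdeal.subset_span ⟨i, j, r, hi, hj, rfl⟩),
      E.mul_mem_bidegree A n (0, 1) (0, 1) _ _ (E.edge_mem_bidegree A n _)
        (E.edge_mem_bidegree A n _)⟩

theorem JModule.iSup_bidegree : ⨆ g : ℤ × ℕ, JModule.bidegree A n g.1 g.2 = ⊤ := by
  refine eq_top_iff.2 fun x _ => ?_
  have h : (⨆ g : ℤ × ℕ, JModule.bidegree A n g.1 g.2).map (JModule A n).subtype =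
      ⨆ g : ℤ × ℕ, JModule A n ⊓ E.bidegree A n g.1 g.2 := by
    rw [Submodule.map_iSup]
    exact iSup_congr fun g => Submodule.map_comap_subtype _ _
  have hx := mem_iSup_of_mem_J A n x.2
  rw [← h] at hx
  obtain ⟨y, hy, hyx⟩ := hx
  rwa [← Subtype.ext (a1 := y) (a2 := x) hyx]

/-- The ideal `J` is a sub-bicomplex of `E(n, A)`. -/
theorem JModule.isBicomplex :
    IsBicomplex (JModule.bidegree A n) (JModule.d' A n) (JModule.d'' A n) where
  isInternal := by
    -- The components of J are separated by the projections of E(n, A) restricted to J. Their values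
    -- may be taken in E(n, A), so it need not be checked that they preserve J.
    refine isInternal_of_projections (JModule.iSup_bidegree A n)
      (JModule A n).injective_subtype (fun g => E.bidegreeProj A n g ∘ₗ (JModule A n).subtype) ?_
    exact fun g h x hx => E.bidegreeProj_of_mem A n g h x hx
  d'_mem p q x hx := by
    have h : (∑ e : Edge n, E.edge A e) * x.1 ∈ E.bidegree A n (0 + p) (1 + q) :=
      E.mul_mem_bidegree A n (0, 1) (p, q) _ _
        (Submodule.sum_mem _ fun e _ => E.edge_mem_bidegree A n e) hx
    rw [zero_add, add_comm] at h
    exact h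
  d''_mem p q x hx := by
    obtain ⟨y, hy, hyx⟩ := (E.mem_bidegree A n (g := (p, q))).1 hx
    refine (E.mem_bidegree A n (g := (p + 1, q))).2 ⟨dPre A n y, Pre.dPre_mem_bidegree A hy, ?_⟩
    change _ = E.d'' A n x.1
    rw [← show _ = x.1 from hyx]
    rfl
  d'_d' x := Subtype.ext (E.d'_d' A n x.1)
  d''_d'' x := Subtype.ext (E.d''_d'' A n x.1)
  d'_d'' x := Subtype.ext ((congrArg (_ + ·) (E.d''_d' A n x.1)).trans (add_neg_cancel _))

end bidegree

end GraphBicomplex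

end

theorem proposition1 {k : Type u} [Field k] (A : GraphBicomplex.CDGA.{u, v} k) (n : ℕ) :
    GraphBicomplex.IsBicomplex (GraphBicomplex.JModule.bidegree A n)
      (GraphBicomplex.JModule.d' A n) (GraphBicomplex.JModule.d'' A n) ∧
    GraphBicomplex.IsAcyclic (GraphBicomplex.JModule.d A n) ∧
    Function.Bijective (GraphBicomplex.cohomologyMap
      (GraphBicomplex.E.d A n) (GraphBicomplex.E.d_d A n)
      (GraphBicomplex.EBar.d A n) (GraphBicomplex.EBar.d_d A n)
      (GraphBicomplex.EBar.proj A n) (GraphBicomplex.EBar.proj_d A n)) :=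
  ⟨GraphBicomplex.JModule.isBicomplex A n, GraphBicomplex.JModule.isAcyclic A n,
    GraphBicomplex.EBar.bijective_cohomologyMap_proj A n⟩
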